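/- Let $\mathrm{AGL}_1=\left\{\begin{pmatrix}1&0\\a&t\end{pmatrix} : a\in\mathbb C,\ t\in\mathbb C^*\right\}$ and, for a group $G$, let $\mathrm{Conj}(G)$ be the quandle $G$ with $a\triangleright b=aba^{-1}$. For $t\in\mathbb C^*$ let $A_t$ be the $t$-Alexander quandle: the set $\mathbb C$ with $a\triangleright b=tb+(1-t)a$. Let $K\subset S^3$ be a tame oriented knot with tubular neighbourhood $N\cong S^1\times D^2$, exterior $E=S^3-\operatorname{int}N$, base point $x_0\in E$, and knot group $\Gamma_K=\pi_1(S^3-K,x_0)$. Joyce's knot quandle $Q_K$ is the set of homotopy classes of paths in $E$ from $x_0$ to $\partial N$, where homotopies fix the initial point and let the endpoint move freely in $\partial N$, with the operation $\alpha\triangleright\beta=\alpha\star m_\alpha\star\bar\alpha\star\beta$, where $m_\alpha$ is the positive meridian loop in $\partial N$ based at the endpoint of $\alpha$. Let $\mu:Q_K\to\mathrm{Conj}(\Gamma_K)$, $\mu(\alpha)=\alpha\star m_\alpha\star\bar\alpha$, be the natural quandle homomorphism. Then $Q_K\neq\emptyset$, and all the maps $\mathrm{Hom}(\Gamma_K,\mathbb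 C^*)\to\mathbb C^*$, $\tau\mapsto\tau(\mu(\alpha))$, $\alpha\in Q_K$, coincide and are a group isomorphism. Composed with it, the projection $\mathrm{AGL}_1\to\mathbb C^*$ onto the diagonal entry $t$ induces the Alexander fibration $$\pi_K:\mathcal R_{\mathrm{AGL}_1}(K)=\mathrm{Hom}(\Gamma_K,\mathrm{AGL}_1)\longrightarrow\mathrm{Hom}(\Gamma_K,\mathbb C^*)=\mathbb C^*.$$ For every $t\in\mathbb C^*$ the following hold. 1. The map $\iota_t:A_t\to\mathrm{Conj}(\mathrm{AGL}_1)$, $a\mapsto\begin{pmatrix}1&0\\a&t\end{pmatrix}$, is an injective quandle homomorphism whose image is the set of all matrices in $\mathrm{AGL}_1$ with diagonal entry $t$. It thus identifies $A_t$ with that subquandle. 2. The fibre $\pi_K^{-1}(t)$ is the quandle representation variety $\mathrm{Hom}_{\mathbf{Qdl}}(Q_K,A_t)$. Precisely, there is a bijection $\Psi_t:\mathrm{Hom}_{\mathbf{Qdl}}(Q_K,A_t)\to\pi_K^{-1}(t)$ such that $\Psi_t(f)(\mu(\alpha))=\iota_t(f(\alpha))$ for all $f$ and all $\alpha\in Q_K$.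 It is an isomorphism of affine varieties: a function $u$ on $\pi_K^{-1}(t)$ is regular (the restriction of a polynomial in the matrix entries of the values $\rho(\gamma)$, $\gamma\in\Gamma_K$) if and only if $u\circ\Psi_t$ is regular (a polynomial in the values $f(\alpha)$, $\alpha\in Q_K$). -/

import Mathlib

open scoped unitInterval Quandles

noncomputable section

/-! ### The group of affine transformations of the complex line -/

/-- `AGL₁(ℂ)`: the matrices `(1 0; a t)` with `a ∈ ℂ` and `t ∈ ℂ^*`. -/
def AGL1 : Subgroup (GL (Fin 2) ℂ) where
  carrier := {A | ∃ (a : ℂ) (t : ℂˣ), (A : Matrix (Fin 2) (Fin 2) ℂ) = !![1, 0; a, (t : ℂ)]}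
  one_mem' := ⟨0, 1, by simp [Matrix.one_fin_two]⟩
  mul_mem' := by
    rintro A B ⟨a, t, hA⟩ ⟨b, s, hB⟩
    refine ⟨a + t * b, t * s, ?_⟩
    rw [Units.val_mul, hA, hB]
    simp
  inv_mem' := by
    rintro A ⟨a, t, hA⟩
    refine ⟨-((t⁻¹ : ℂˣ) : ℂ) * a, t⁻¹, ?_⟩
    rw [Matrix.coe_units_inv]
    apply Matrix.inv_eq_left_inv
    rw [hA]
    simp [Matrix.one_fin_two]

namespace AGL1

/-- The `(i, j)` entry of an element of `AGL₁(ℂ)`. -/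
def entry (A : AGL1) (i j : Fin 2) : ℂ := ((A : GL (Fin 2) ℂ) : Matrix (Fin 2) (Fin 2) ℂ) i j

theorem entry_zero_zero (A : AGL1) : entry A 0 0 = 1 := by
  obtain ⟨A, a, t, h⟩ := A
  simp [entry, h]

theorem entry_zero_one (A : AGL1) : entry A 0 1 = 0 := by
  obtain ⟨A, a, t, h⟩ := A
  simp [entry, h]

theorem entry_mul (A B : AGL1) (i j : Fin 2) :
    entry (A * B) i j = entry A i 0 * entry B 0 j + entry A i 1 * entry B 1 j := by
  simp [entry, Matrix.mul_apply, Fin.sum_univ_two]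

/-- The matrix `(1 0; a t)`. -/
def mk (a : ℂ) (t : ℂˣ) : AGL1 :=
  ⟨⟨!![1, 0; a, (t : ℂ)], !![1, 0; -((t⁻¹ : ℂˣ) : ℂ) * a, ((t⁻¹ : ℂˣ) : ℂ)],
    by simp [Matrix.one_fin_two],
    by simp [Matrix.one_fin_two]⟩, a, t, rfl⟩

/-- The projection `AGL₁(ℂ) → ℂ^*` onto the diagonal entry `t`. -/
def diag : AGL1 →* ℂˣ :=
  MonoidHom.toHomUnits
    { toFun := fun A => entry A 1 1
      map_one' := by simp [entry]
      map_mul' := fun A B => by simp [entry_mul, entry_zero_one] }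

theorem ext_iff' (A B : AGL1) : A = B ↔ entry A 1 0 = entry B 1 0 ∧ entry A 1 1 = entry B 1 1 := by
  constructor
  · rintro rfl
    exact ⟨rfl, rfl⟩
  · rintro ⟨h1, h2⟩
    apply Subtype.ext
    apply Units.ext
    ext i j
    have h3 := (entry_zero_zero A).trans (entry_zero_zero B).symm
    have h4 := (entry_zero_one A).trans (entry_zero_one B).symm
    fin_cases i <;> fin_cases j
    · exact h3
    · exact h4
    · exact h1
    · exact h2

end AGL1

/-! ### Alexander quandles -/

/-- The `t`-Alexander quandle `A_t`; its underlying set is `ℂ`. -/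
@[ext]
structure AlexanderQuandle (t : ℂˣ) where
  val : ℂ

namespace AlexanderQuandle

variable {t : ℂˣ}

/-- `a ◃ b = t b + (1 - t) a` and `a ◃⁻¹ b = t⁻¹ b + (1 - t⁻¹) a`. -/
instance : Quandle (AlexanderQuandle t) where
  act a b := ⟨t * b.val + (1 - t) * a.val⟩
  invAct a b := ⟨((t⁻¹ : ℂˣ) : ℂ) * b.val + (1 - ((t⁻¹ : ℂˣ) : ℂ)) * a.val⟩
  self_distrib := by
    intro x y z
    ext
    dsimp only
    ring
  left_inv := by
    intro x y
    have h : ((t⁻¹ : ℂˣ) : ℂ) * t = 1 := by simp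
    ext
    dsimp only
    linear_combination (y.val - x.val : ℂ) * h
  right_inv := by
    intro x y
    have h : ((t⁻¹ : ℂˣ) : ℂ) * t = 1 := by simp
    ext
    dsimp only
    linear_combination (y.val - x.val : ℂ) * h
  fix := by
    intro x
    ext
    dsimp only
    ring

/-- The quandle homomorphism `A_t → Conj(AGL₁)`, `a ↦ (1 0; a t)`. -/
def toConjAGL1 (t : ℂˣ) : AlexanderQuandle t →◃ Quandle.Conj AGL1 where
  toFun a := AGL1.mk a.val t
  map_act' := by
    intro x y
    rw [Quandle.conj_act_eq_conj, eq_mul_inv_iff_mul_eq, AGL1.ext_iff']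
    simp only [AGL1.entry_mul]
    simp only [AGL1.mk, AGL1.entry, Shelf.act]
    constructor
    · simp
      ring
    · simp

end AlexanderQuandle

/-! ### Tame knots in the three-sphere -/

/-- The unit sphere `S³` of `ℝ⁴`. -/
abbrev S3 : Type := Metric.sphere (0 : EuclideanSpace ℝ (Fin 4)) 1

/-- A knot: a simple closed curve in `S³`, oriented by its parametrization. -/
structure Knot where
  curve : C(Circle, S3)
  injective_curve : Function.Injective curve

/-- The complement `S³ - K`. -/
abbrev Knot.Complement (K : Knot) : Type := {x : S3 // x ∉ Set.range K.curve}

/-- A parametrized tubular neighbourhood of the knot `K`: the solid torus `tube (S¹ × D)`, `D` the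
closed unit disc, together with an open collar. A knot is tame if and only if it has one. Meridians
run counterclockwise in the discs `{z} × D`; they are the positive meridians of `K` if `tube`
preserves the orientations, and those of `K` with the opposite orientation if it reverses them. -/
structure TubularNeighbourhood (K : Knot) where
  tube : Circle × ℂ → S3
  isOpenEmbedding_tube : Topology.IsOpenEmbedding tube
  tube_core : ∀ z : Circle, tube (z, 0) = K.curve z

namespace TubularNeighbourhood

variable {K : Knot} (N : TubularNeighbourhood K)

/-- The exterior `E` of `K`: the complement of the interior of the solid torus. -/
abbrev Exterior : Type := {x : S3 // x ∉ N.tube '' {p | ‖p.2‖ < 1}}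

/-- The parametrization of the boundary torus `∂N ⊆ E` by `S¹ × S¹`. -/
def boundary : C(Circle × Circle, N.Exterior) where
  toFun p := ⟨N.tube (p.1, (p.2 : ℂ)), by
    rintro ⟨q, hq, h⟩
    rw [N.isOpenEmbedding_tube.injective h] at hq
    have h1 : ‖(p.2 : ℂ)‖ = 1 := p.2.norm_coe
    exact absurd hq (by simp [h1])⟩
  continuous_toFun := by
    have := N.isOpenEmbedding_tube.continuous
    fun_prop

theorem isEmbedding_boundary : Topology.IsEmbedding N.boundary := by
  have h1 : Topology.IsEmbedding fun p : Circle × Circle => N.tube (p.1, (p.2 : ℂ)) :=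
    N.isOpenEmbedding_tube.isEmbedding.comp
      (Topology.IsEmbedding.id.prodMap Topology.IsEmbedding.subtypeVal)
  exact Topology.IsEmbedding.of_comp N.boundary.continuous continuous_subtype_val h1

/-- The inclusion of the exterior into the knot complement. -/
def inclusion : C(N.Exterior, K.Complement) where
  toFun x := ⟨x.1, by
    rintro ⟨z, hz⟩
    exact x.2 ⟨(z, 0), by simp, (N.tube_core z).trans hz⟩⟩
  continuous_toFun := by fun_prop

/-! ### Meridian loops -/

/-- The meridian in the torus `S¹ × S¹` starting at `p`. -/
def torusMeridian (p : Circle × Circle) : Path p p where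
  toFun s := (p.1, p.2 * Circle.exp (2 * Real.pi * s))
  continuous_toFun := by fun_prop
  source' := by simp
  target' := by simp

/-- The positively oriented meridian circle of `∂N` through the boundary point `p`. -/
def meridianLoop (p : Circle × Circle) : Path (N.boundary p) (N.boundary p) :=
  (torusMeridian p).map N.boundary.continuous

theorem torusMeridian_natural {p q : Circle × Circle} (δ : Path p q) :
    (δ.trans (torusMeridian q)).Homotopic ((torusMeridian p).trans δ) := by
  let F : (ContinuousMap.id (Circle × Circle)).Homotopy (ContinuousMap.id (Circle × Circle)) :=
    { toFun := fun x => (x.2.1, x.2.2 * Circle.exp (2 * Real.pi * x.1))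
      continuous_toFun := by fun_prop
      map_zero_left := fun x => by simp
      map_one_left := fun x => by simp }
  exact Path.Homotopic.map_trans_evalAt F δ

/-! ### The knot quandle -/

/-- A path in the exterior from the base point to a point of `∂N`. -/
structure BoundaryPath (x₀ : N.Exterior) where
  endpoint : Circle × Circle
  path : Path x₀ (N.boundary endpoint)

variable {N}
variable {x₀ : N.Exterior}

/-- Paths from `x₀` to `∂N` are homotopic if there is a homotopy between them that keeps the
initial point fixed, while the endpoint moves freely in `∂N`. -/
def BoundaryPath.Homotopic (α β : N.BoundaryPath x₀) : Prop :=
  ContinuousMap.HomotopicWith (α.path : C(I, N.Exterior)) (β.path : C(I, N.Exterior))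
    fun γ => γ 0 = x₀ ∧ γ 1 ∈ Set.range N.boundary

theorem BoundaryPath.homotopic_of_path {α β : N.BoundaryPath x₀} (δ : Path α.endpoint β.endpoint)
    (h : (α.path.trans (δ.map N.boundary.continuous)).Homotopic β.path) : α.Homotopic β := by
  obtain ⟨H⟩ := h
  let γ := α.path.trans (δ.map N.boundary.continuous)
  let w : I × I → ℝ := fun x => (1 / 2 + x.1 / 2) * x.2
  have hw : ∀ x, w x ∈ I := by
    rintro ⟨⟨u, hu0, hu1⟩, ⟨s, hs0, hs1⟩⟩
    refine ⟨?_, ?_⟩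
    · simp only [w]; positivity
    · simp only [w]; nlinarith
  have hγ : ∀ s : ℝ, ∀ hs : s ∈ I, 1 / 2 ≤ s →
      γ ⟨s, hs⟩ = N.boundary (δ.extend (2 * s - 1)) := by
    intro s hs h2
    have h3 : 2 * s - 1 ∈ I := ⟨by linarith, by linarith [hs.2]⟩
    rw [Path.extend_apply _ h3]
    rcases h2.eq_or_lt with h4 | h4
    · subst h4
      simp [γ, Path.trans_apply]
    · simp [γ, Path.trans_apply, not_le.2 (show 2⁻¹ < s by linarith)]
  have first : ContinuousMap.HomotopicWith (α.path : C(I, N.Exterior)) (γ : C(I, N.Exterior))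
      fun γ => γ 0 = x₀ ∧ γ 1 ∈ Set.range N.boundary := by
    refine ⟨⟨⟨⟨fun x => γ ⟨w x, hw x⟩, by fun_prop⟩, ?_, ?_⟩, ?_⟩⟩
    · intro s
      have : (2 : ℝ)⁻¹ * s ≤ 2⁻¹ := by nlinarith [s.2.2]
      simp [γ, w, Path.trans_apply, this]
    · intro s
      have : w (1, s) = s := by simp [w]; ring
      simp [this]
    · intro u
      refine ⟨?_, ?_⟩
      · have : w (u, 0) = 0 := by simp [w]
        simp [this]
      · refine ⟨δ.extend (2 * w (u, 1) - 1), (hγ (w (u, 1)) (hw _) ?_).symm⟩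
        have := u.2.1
        simp only [w, Set.Icc.coe_one]
        linarith
  refine first.trans ⟨⟨H.toHomotopy, ?_⟩⟩
  intro u
  refine ⟨?_, ?_⟩
  · exact H.source u
  · exact ⟨β.endpoint, (H.target u).symm⟩

theorem BoundaryPath.Homotopic.exists_path {α β : N.BoundaryPath x₀} (h : α.Homotopic β) :
    ∃ δ : Path α.endpoint β.endpoint, (α.path.trans (δ.map N.boundary.continuous)).Homotopic β.path := by
  obtain ⟨H⟩ := h
  choose e he using fun u => (H.prop' u).2
  have hc : Continuous e := by
    rw [N.isEmbedding_boundary.continuous_iff]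
    have : N.boundary ∘ e = fun u => H (u, 1) := funext he
    rw [this]
    fun_prop
  have inj := N.isEmbedding_boundary.injective
  have s0 : e 0 = α.endpoint := inj ((he 0).trans ((H.apply_zero 1).trans (by simp)))
  have s1 : e 1 = β.endpoint := inj ((he 1).trans ((H.apply_one 1).trans (by simp)))
  let ι : Path (0 : I) 1 := ⟨ContinuousMap.id I, rfl, rfl⟩
  have key := (Path.Homotopic.map_trans_evalAt H.toHomotopy ι).pathCast
    (x₂ := x₀) (x₃ := N.boundary β.endpoint) (by simp) (by simp)
  refine ⟨⟨⟨e, hc⟩, s0, s1⟩, ?_⟩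
  have h0 : ∀ u, H (u, 0) = x₀ := fun u => (H.prop' u).1
  have hl : α.path.trans ((⟨⟨e, hc⟩, s0, s1⟩ : Path α.endpoint β.endpoint).map N.boundary.continuous) =
      (((ι.map (map_continuous (α.path : C(I, N.Exterior)))).trans
        (H.toHomotopy.evalAt 1)).cast (by simp) (by simp)) := by
    refine Path.ext (funext fun s => ?_)
    simp only [Path.trans_apply, Path.cast_coe]
    split_ifs
    · rfl
    · exact he _
  have hr : (Path.refl x₀).trans β.path =
      (((H.toHomotopy.evalAt 0).trans
        (ι.map (map_continuous (β.path : C(I, N.Exterior))))).cast (by simp) (by simp)) := by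
    refine Path.ext (funext fun s => ?_)
    simp only [Path.trans_apply, Path.cast_coe]
    split_ifs
    · exact (h0 _).symm
    · rfl
  rw [← hl, ← hr] at key
  exact key.trans (Path.Homotopic.refl_trans _)

/-- The loop `α ⋆ m_α ⋆ ᾱ` based at `x₀`. -/
def BoundaryPath.loop (α : N.BoundaryPath x₀) : Path x₀ x₀ :=
  α.path.trans ((N.meridianLoop α.endpoint).trans α.path.symm)

/-- The path `α ⋆ m_α ⋆ ᾱ ⋆ β`. -/
def BoundaryPath.act (α β : N.BoundaryPath x₀) : N.BoundaryPath x₀ :=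
  ⟨β.endpoint, α.loop.trans β.path⟩

/-- The path `α ⋆ m̄_α ⋆ ᾱ ⋆ β`. -/
def BoundaryPath.invAct (α β : N.BoundaryPath x₀) : N.BoundaryPath x₀ :=
  ⟨β.endpoint, α.loop.symm.trans β.path⟩

theorem BoundaryPath.Homotopic.loop {α β : N.BoundaryPath x₀} (h : α.Homotopic β) :
    α.loop.Homotopic β.loop := by
  obtain ⟨δ, hδ⟩ := h.exists_path
  have h1 := (torusMeridian_natural δ).map N.boundary
  rw [Path.map_trans, Path.map_trans] at h1
  have h2 : (N.meridianLoop α.endpoint).Homotopic ((δ.map N.boundary.continuous).trans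
      ((N.meridianLoop β.endpoint).trans (δ.map N.boundary.continuous).symm)) := by
    refine Path.Homotopic.trans ?_ (Path.Homotopic.trans_assoc _ _ _)
    refine Path.Homotopic.trans ?_ (h1.symm.hcomp (Path.Homotopic.refl _))
    rw [← Path.Homotopic.Quotient.eq]
    simp only [Path.Homotopic.Quotient.mk_trans, Path.Homotopic.Quotient.mk_symm,
      Path.Homotopic.Quotient.trans_assoc, Path.Homotopic.Quotient.trans_symm,
      Path.Homotopic.Quotient.trans_refl]
    rfl
  have h3 : α.loop.Homotopic ((α.path.trans (δ.map N.boundary.continuous)).trans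
      ((N.meridianLoop β.endpoint).trans
        (α.path.trans (δ.map N.boundary.continuous)).symm)) := by
    refine ((Path.Homotopic.refl α.path).hcomp (h2.hcomp (Path.Homotopic.refl _))).trans ?_
    rw [← Path.Homotopic.Quotient.eq]
    simp [Path.trans_symm]
  exact h3.trans (hδ.hcomp ((Path.Homotopic.refl _).hcomp hδ.symm₂))

theorem BoundaryPath.loop_act (α β : N.BoundaryPath x₀) :
    (α.act β).loop.Homotopic (α.loop.trans (β.loop.trans α.loop.symm)) := by
  refine Path.Homotopic.Quotient.eq.1 ?_
  simp [BoundaryPath.loop, BoundaryPath.act, Path.trans_symm]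

theorem BoundaryPath.homotopic_of_eq {p : Circle × Circle} {α β : Path x₀ (N.boundary p)}
    (h : α.Homotopic β) : BoundaryPath.Homotopic (⟨p, α⟩ : N.BoundaryPath x₀) ⟨p, β⟩ := by
  refine BoundaryPath.homotopic_of_path (Path.refl p) ?_
  have : (Path.refl p).map N.boundary.continuous = Path.refl _ := rfl
  rw [this]
  exact (Path.Homotopic.trans_refl α).trans h

theorem BoundaryPath.homotopic_trans {α β : N.BoundaryPath x₀} {l l' : Path x₀ x₀}
    (hl : l.Homotopic l') (h : α.Homotopic β) :
    BoundaryPath.Homotopic (⟨α.endpoint, l.trans α.path⟩ : N.BoundaryPath x₀) ⟨β.endpoint, l'.trans β.path⟩ := by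
  obtain ⟨δ, hδ⟩ := h.exists_path
  exact BoundaryPath.homotopic_of_path δ
    ((Path.Homotopic.trans_assoc _ _ _).trans (hl.hcomp hδ))

variable (N x₀)

/-- Homotopy of paths from the base point to `∂N`, as an equivalence relation. -/
def boundaryPathSetoid : Setoid (N.BoundaryPath x₀) where
  r := BoundaryPath.Homotopic
  iseqv :=
    { refl := fun α => BoundaryPath.homotopic_of_eq (Path.Homotopic.refl α.path)
      symm := fun h => ContinuousMap.HomotopicWith.symm h
      trans := fun h h' => ContinuousMap.HomotopicWith.trans h h' }

/-- The knot quandle `Q_K`: homotopy classes of paths in the exterior from `x₀` to `∂N`. -/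
def KnotQuandle : Type := Quotient (N.boundaryPathSetoid x₀)

variable {N x₀}

/-- The operation `α ◃ β = α ⋆ m_α ⋆ ᾱ ⋆ β` of the knot quandle. -/
instance : Quandle (N.KnotQuandle x₀) where
  act := Quotient.map₂ BoundaryPath.act
    fun _ _ h _ _ h' => BoundaryPath.homotopic_trans (BoundaryPath.Homotopic.loop h) h'
  invAct := Quotient.map₂ BoundaryPath.invAct
    fun _ _ h _ _ h' => BoundaryPath.homotopic_trans (BoundaryPath.Homotopic.loop h).symm₂ h'
  self_distrib := by
    rintro ⟨α⟩ ⟨β⟩ ⟨γ⟩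
    refine Quotient.sound (BoundaryPath.homotopic_of_eq (Path.Homotopic.trans ?_
      ((BoundaryPath.loop_act α β).symm.hcomp (Path.Homotopic.refl _))))
    refine Path.Homotopic.Quotient.eq.1 ?_
    simp only [BoundaryPath.act, Path.Homotopic.Quotient.mk_trans,
      Path.Homotopic.Quotient.mk_symm, Path.Homotopic.Quotient.trans_assoc]
    rw [← Path.Homotopic.Quotient.trans_assoc (Path.Homotopic.Quotient.symm _)]
    simp
  left_inv := by
    rintro ⟨α⟩ ⟨β⟩
    refine Quotient.sound (BoundaryPath.homotopic_of_eq ?_)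
    refine Path.Homotopic.Quotient.eq.1 ?_
    simp only [BoundaryPath.act, Path.Homotopic.Quotient.mk_trans,
      Path.Homotopic.Quotient.mk_symm]
    rw [← Path.Homotopic.Quotient.trans_assoc]
    simp
  right_inv := by
    rintro ⟨α⟩ ⟨β⟩
    refine Quotient.sound (BoundaryPath.homotopic_of_eq ?_)
    refine Path.Homotopic.Quotient.eq.1 ?_
    simp only [BoundaryPath.invAct, Path.Homotopic.Quotient.mk_trans,
      Path.Homotopic.Quotient.mk_symm]
    rw [← Path.Homotopic.Quotient.trans_assoc]
    simp
  fix := by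
    rintro ⟨α⟩
    refine Quotient.sound (BoundaryPath.homotopic_of_path (torusMeridian α.endpoint).symm ?_)
    have h : (torusMeridian α.endpoint).symm.map N.boundary.continuous =
      (N.meridianLoop α.endpoint).symm := rfl
    refine Path.Homotopic.Quotient.eq.1 ?_
    simp only [BoundaryPath.act, BoundaryPath.loop, h, Path.Homotopic.Quotient.mk_trans,
      Path.Homotopic.Quotient.mk_symm, Path.Homotopic.Quotient.trans_assoc]
    rw [← Path.Homotopic.Quotient.trans_assoc (Path.Homotopic.Quotient.symm _)]
    simp

/-! ### The knot group and representation varieties -/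

variable (N x₀)

/-- The knot group `Γ_K = π₁(S³ - K, x₀)`. The product of two loops traverses the first factor
first; Mathlib's `FundamentalGroup` has the opposite product. -/
def KnotGroup : Type := (FundamentalGroup K.Complement (N.inclusion x₀))ᵐᵒᵖ

instance : Group (N.KnotGroup x₀) :=
  inferInstanceAs (Group (FundamentalGroup K.Complement (N.inclusion x₀))ᵐᵒᵖ)

variable {N x₀}

/-- The natural map `Q_K → Conj(Γ_K)`, `α ↦ α ⋆ m_α ⋆ ᾱ`. -/
def meridian : N.KnotQuandle x₀ →◃ Quandle.Conj (N.KnotGroup x₀) where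
  toFun := Quotient.lift
    (fun α => MulOpposite.op (FundamentalGroup.fromPath
      (Path.Homotopic.Quotient.mk (α.loop.map N.inclusion.continuous))))
    fun _ _ h => congrArg MulOpposite.op (Path.Homotopic.Quotient.eq.2
      ((BoundaryPath.Homotopic.loop h).map N.inclusion))
  map_act' := by
    rintro ⟨α⟩ ⟨β⟩
    refine (congrArg MulOpposite.op (Path.Homotopic.Quotient.eq.2
      ((BoundaryPath.loop_act α β).map N.inclusion))).trans ?_
    rw [Path.map_trans, Path.map_trans]
    exact congrArg MulOpposite.op (Path.Homotopic.Quotient.trans_assoc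
      (Path.Homotopic.Quotient.mk (α.loop.map N.inclusion.continuous))
      (Path.Homotopic.Quotient.mk (β.loop.map N.inclusion.continuous))
      (Path.Homotopic.Quotient.mk (α.loop.symm.map N.inclusion.continuous))).symm

end TubularNeighbourhood

/-! ### Representation varieties and the Alexander fibration -/

/-- The map `Hom(Γ, AGL₁) → Hom(Γ, ℂ^*)` induced by the projection to the diagonal entry. -/
def alexanderFibration {Γ : Type*} [Group Γ] (ρ : Γ →* AGL1) : Γ →* ℂˣ := AGL1.diag.comp ρ

/-- The algebra of regular functions of the representation variety `Hom(Γ, AGL₁)`: the polynomials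
in the matrix entries of the values of a representation. Entries of inverses are among them, so
that for generators `x₁, …, xₙ` of `Γ` these are the restrictions of the regular functions of the
affine variety `(AGL₁)ⁿ`. -/
def groupRegularFunctions (Γ : Type*) [Group Γ] : Subalgebra ℂ ((Γ →* AGL1) → ℂ) :=
  Algebra.adjoin ℂ {u | ∃ (γ : Γ) (i j : Fin 2), u = fun ρ => AGL1.entry (ρ γ) i j}

/-- Regular functions of a subvariety of `Hom(Γ, AGL₁)`: the restrictions of regular functions. -/
def IsRegularOn {Γ : Type*} [Group Γ] (S : Set (Γ →* AGL1)) (u : S → ℂ) : Prop :=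
  ∃ v ∈ groupRegularFunctions Γ, ∀ ρ : S, u ρ = v ρ

/-- The algebra of regular functions of the quandle representation variety `Hom(Q, A_t)`: the
polynomials in the values of a quandle homomorphism. -/
def quandleRegularFunctions (Q : Type*) [Quandle Q] (t : ℂˣ) :
    Subalgebra ℂ ((Q →◃ AlexanderQuandle t) → ℂ) :=
  Algebra.adjoin ℂ {u | ∃ q : Q, u = fun f => (f q).val}

end

/-! The algebra uses only what `MeridionalAction` records: `Γ` acts transitively on a nonempty `Q`,
`μ α` acts as `α ◃ ·`, the `μ α` generate `Γ`, and a character `lk` is `1` on each of them. Hence a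
homomorphism to a commutative group is constant on meridians, and any homomorphism is determined by
its meridian values. Conversely, let `f : Q → A_t`. Each generator changes the values of `f` by an
affine map of ratio `t`, so `γ` changes them by `x ↦ χ(γ) x + b(γ)`, where `χ` is the character with
meridian value `t` and `b` is a `χ`-cocycle (`val_smul_sub`). Since `b (μ α) = (1 - t) f α`,
dividing by `1 - t` gives the representation when `t ≠ 1`; for `t = 1` the map `f` is constant and a
multiple of `lk` serves (`exists_hom`). On a fibre the diagonal entry of `ρ γ` does not depend on
`ρ`, so the remaining entry is linear in meridian values, and regular functions correspond.

The topological inputs are transitivity, which holds because `∂N` is path connected, the character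
`lk`, and generation by meridians. The last two come from one device: a torsor over `S³`, pulled
back to a cube, is trivial (`exists_isTorsorSection_Icc`), and the trivialization can be read on
`S³` minus one point of the knot. The circle torsor glued by `w / ‖w‖` around the knot yields a map
from the complement to `S¹` of degree one on a meridian, hence `lk`. If a homomorphism `φ` to a
group `G` kills the meridians, its discrete `G`-torsor extends across the knot; triviality gives a
potential, so `φ = 1` (`eq_one_of_meridian`). As `μ` is equivariant for conjugation, the subgroup
generated by the meridians is normal, and its quotient map must be trivial. -/

namespace AGL1

/-! ### Matrix calculus in the affine group -/

@[simp] theorem diag_val (A : AGL1) : (diag A : ℂ) = entry A 1 1 := rfl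

@[simp] theorem entry_one_zero_mk (a : ℂ) (t : ℂˣ) : entry (mk a t) 1 0 = a := by
  simp [entry, mk]

@[simp] theorem entry_one_one_mk (a : ℂ) (t : ℂˣ) : entry (mk a t) 1 1 = t := by
  simp [entry, mk]

@[simp] theorem diag_mk (a : ℂ) (t : ℂˣ) : diag (mk a t) = t := Units.ext (by simp)

theorem mk_mul_mk (a b : ℂ) (s t : ℂˣ) : mk a s * mk b t = mk (a + s * b) (s * t) := by
  rw [ext_iff']
  simp [entry_mul, entry_zero_zero, entry_zero_one]

theorem mk_entry_diag (A : AGL1) : mk (entry A 1 0) (diag A) = A := by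
  rw [ext_iff']
  simp

theorem mk_entry_of_diag_eq {A : AGL1} {t : ℂˣ} (h : diag A = t) : mk (entry A 1 0) t = A :=
  h ▸ mk_entry_diag A

theorem mk_injective {a b : ℂ} {s t : ℂˣ} (h : mk a s = mk b t) : a = b := by
  have := (ext_iff' _ _).1 h
  simpa using this.1

/-- The homomorphism to `AGL₁(ℂ)` given by a character `τ` and a `τ`-cocycle `b`. -/
noncomputable def ofCocycle {Γ : Type*} [Group Γ] (τ : Γ →* ℂˣ) (b : Γ → ℂ)
    (hb : ∀ γ γ', b (γ * γ') = b γ + τ γ * b γ') : Γ →* AGL1 :=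
  MonoidHom.mk' (fun γ => mk (b γ) (τ γ)) fun γ γ' => by rw [mk_mul_mk, hb, map_mul]

theorem entry_inv_one_zero (A : AGL1) :
    entry A⁻¹ 1 0 = -((diag A)⁻¹ : ℂˣ) * entry A 1 0 := by
  have h : A⁻¹ = mk (-((diag A)⁻¹ : ℂˣ) * entry A 1 0) (diag A)⁻¹ := by
    rw [inv_eq_iff_mul_eq_one]
    conv_lhs => rw [← mk_entry_diag A]
    rw [mk_mul_mk, ext_iff']
    have h1 : entry (1 : AGL1) 1 0 = 0 := by simp [entry]
    have h2 : entry (1 : AGL1) 1 1 = 1 := by simp [entry]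
    rw [h1, h2, diag_mk, entry_one_zero_mk, mul_inv_cancel, entry_one_zero_mk, entry_one_one_mk, ← mul_assoc, mul_neg,
      ← Units.val_mul, mul_inv_cancel]
    simp
  rw [h, entry_one_zero_mk]

end AGL1

/-! ### The embedding of an Alexander quandle -/

namespace AlexanderQuandle

theorem val_act {t : ℂˣ} (a b : AlexanderQuandle t) :
    (a ◃ b).val = t * b.val + (1 - t) * a.val := rfl

theorem toConjAGL1_apply {t : ℂˣ} (a : AlexanderQuandle t) :
    toConjAGL1 t a = AGL1.mk a.val t := rfl

theorem toConjAGL1_injective (t : ℂˣ) : Function.Injective (toConjAGL1 t) :=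
  fun _ _ h => AlexanderQuandle.ext (AGL1.mk_injective h)

theorem range_toConjAGL1 (t : ℂˣ) :
    Set.range (toConjAGL1 t) = {A : AGL1 | AGL1.diag A = t} := by
  ext A
  constructor
  · rintro ⟨a, rfl⟩
    exact AGL1.diag_mk _ _
  · rintro rfl
    exact ⟨⟨AGL1.entry A 1 0⟩, AGL1.mk_entry_diag A⟩

end AlexanderQuandle

/-! ### Representations of a group with a meridional action -/

/-- A group `Γ` that is generated by the image of a quandle homomorphism `μ : Q → Conj(Γ)` and acts
transitively on `Q` in such a way that `μ α` acts by `α ◃ ·`, with a character `lk` that takes the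
value `1` on all `μ α`. -/
structure MeridionalAction {Γ Q : Type*} [Group Γ] [Quandle Q] [MulAction Γ Q]
    (μ : Q →◃ Quandle.Conj Γ) (lk : Γ →* Multiplicative ℂ) : Prop where
  smul_eq : ∀ α β : Q, (μ α : Γ) • β = α ◃ β
  closure_eq_top : Subgroup.closure (Set.range fun α => (μ α : Γ)) = ⊤
  isPretransitive : MulAction.IsPretransitive Γ Q
  nonempty : Nonempty Q
  lk_eq : ∀ α, lk (μ α) = Multiplicative.ofAdd 1

namespace MeridionalAction

variable {Γ Q : Type*} [Group Γ] [Quandle Q] [MulAction Γ Q]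
  {μ : Q →◃ Quandle.Conj Γ} {lk : Γ →* Multiplicative ℂ}

theorem hom_ext (h : MeridionalAction μ lk) {G : Type*} [Group G] {ρ ρ' : Γ →* G}
    (hρ : ∀ α, ρ (μ α) = ρ' (μ α)) : ρ = ρ' := by
  refine MonoidHom.eq_of_eqOn_dense h.closure_eq_top ?_
  rintro _ ⟨α, rfl⟩
  exact hρ α

/-- Invariance under each `α ◃ ·` is invariance under the generators, hence under all of `Γ`, whose
action is transitive. -/
theorem apply_eq_of_act_eq (h : MeridionalAction μ lk) {Y : Type*} {f : Q → Y}
    (hf : ∀ α β, f (α ◃ β) = f β) (α β : Q) : f α = f β := by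
  have key : ∀ γ : Γ, ∀ β, f (γ • β) = f β := by
    intro γ
    have hγ : γ ∈ Subgroup.closure (Set.range fun α => (μ α : Γ)) := by simp [h.closure_eq_top]
    induction hγ using Subgroup.closure_induction with
    | mem x hx =>
      obtain ⟨α, rfl⟩ := hx
      intro β
      simp only [h.smul_eq, hf]
    | one => simp
    | mul x y _ _ hx hy => intro β; rw [mul_smul, hx, hy]
    | inv x _ hx => intro β; rw [← hx, smul_inv_smul]
  obtain ⟨γ, rfl⟩ := h.isPretransitive.exists_smul_eq β α
  exact key γ β

/-- `μ (α ◃ β)` is a conjugate of `μ β`, which a commutative target cannot distinguish from it. -/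
theorem hom_apply_eq (h : MeridionalAction μ lk) {A : Type*} [CommGroup A] (τ : Γ →* A) (α β : Q) :
    τ (μ α) = τ (μ β) := by
  refine h.apply_eq_of_act_eq (f := fun α => τ (μ α)) (fun α β => ?_) α β
  have h1 : μ (α ◃ β) = (μ α : Γ) * μ β * (μ α : Γ)⁻¹ := μ.map_act
  rw [h1]
  simp

/-- The character of `Γ` that takes the value `t` on all `μ α`. -/
noncomputable def character (lk : Γ →* Multiplicative ℂ) (t : ℂˣ) : Γ →* ℂˣ :=
  MonoidHom.toHomUnits
    -- This is `t ^ lk γ`. Any logarithm of `t` would do, since only the value at `lk = 1` matters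
    -- on the generators.
    { toFun := fun γ => Complex.exp (Complex.log t * (lk γ).toAdd)
      map_one' := by simp
      map_mul' := fun γ γ' => by rw [← Complex.exp_add, map_mul, toAdd_mul, mul_add] }

theorem character_apply (h : MeridionalAction μ lk) (t : ℂˣ) (α : Q) :
    character lk t (μ α) = t := by
  ext
  simp [character, h.lk_eq, Complex.exp_log]

/-- Evaluation of characters at the elements `μ α`. -/
noncomputable def evalEquiv (h : MeridionalAction μ lk) : (Γ →* ℂˣ) ≃* ℂˣ :=
  MulEquiv.ofBijective
    ({ toFun := fun τ => τ (μ h.nonempty.some)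
       map_one' := rfl
       map_mul' := fun _ _ => rfl } : (Γ →* ℂˣ) →* ℂˣ)
    ⟨fun τ τ' hτ => h.hom_ext fun α => by
      rw [h.hom_apply_eq τ α h.nonempty.some, h.hom_apply_eq τ' α h.nonempty.some]
      exact hτ,
    fun t => ⟨character lk t, h.character_apply t _⟩⟩

theorem evalEquiv_apply (h : MeridionalAction μ lk) (τ : Γ →* ℂˣ) (α : Q) :
    h.evalEquiv τ = τ (μ α) := h.hom_apply_eq τ h.nonempty.some α

theorem mem_fibre_iff (h : MeridionalAction μ lk) {t : ℂˣ} {ρ : Γ →* AGL1} :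
    h.evalEquiv (alexanderFibration ρ) = t ↔ ∀ α, AGL1.diag (ρ (μ α)) = t :=
  ⟨fun hρ α => (h.evalEquiv_apply _ α).symm.trans hρ,
    fun hρ => (h.evalEquiv_apply _ h.nonempty.some).trans (hρ _)⟩

/-- Two characters with the same meridian values agree. Thus the diagonal entry is constant along a
fibre, which makes the cocycle rule linear there. -/
theorem diag_apply (h : MeridionalAction μ lk) {t : ℂˣ} {ρ : Γ →* AGL1}
    (hρ : h.evalEquiv (alexanderFibration ρ) = t) (γ : Γ) :
    AGL1.diag (ρ γ) = character lk t γ := by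
  refine DFunLike.congr_fun (h.hom_ext (ρ := alexanderFibration ρ) fun α => ?_) γ
  rw [h.character_apply]
  exact h.mem_fibre_iff.1 hρ α

/-- The map `b ↦ t b + (1 - t) a` has linear part `t` whatever `a` is, so linear parts multiply
along words in the generators. -/
theorem val_smul_sub (h : MeridionalAction μ lk) {t : ℂˣ} (f : Q →◃ AlexanderQuandle t) (γ : Γ)
    (p q : Q) :
    (f (γ • p)).val - (f (γ • q)).val = character lk t γ * ((f p).val - (f q).val) := by
  have hγ : γ ∈ Subgroup.closure (Set.range fun α => (μ α : Γ)) := by simp [h.closure_eq_top]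
  induction hγ using Subgroup.closure_induction generalizing p q with
  | mem x hx =>
    obtain ⟨α, rfl⟩ := hx
    simp only [h.smul_eq, h.character_apply, f.map_act, AlexanderQuandle.val_act]
    ring
  | one => simp
  | mul x y _ _ hx hy => rw [mul_smul, mul_smul, hx, hy, map_mul, Units.val_mul, mul_assoc]
  | inv x _ hx =>
    have h1 := hx (x⁻¹ • p) (x⁻¹ • q)
    rw [smul_inv_smul, smul_inv_smul] at h1
    rw [h1, ← mul_assoc, ← Units.val_mul, ← map_mul]
    simp

/-- Every quandle homomorphism `Q → A_t` comes from a homomorphism `Γ → AGL₁`. -/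
theorem exists_hom (h : MeridionalAction μ lk) {t : ℂˣ} (f : Q →◃ AlexanderQuandle t) :
    ∃ ρ : Γ →* AGL1, ∀ α, ρ (μ α) = AlexanderQuandle.toConjAGL1 t (f α) := by
  obtain ⟨q⟩ := h.nonempty
  by_cases ht : t = 1
  · subst ht
    have hf : ∀ α, (f α).val = (f q).val := fun α =>
      h.apply_eq_of_act_eq (f := fun α => (f α).val)
        (fun α β => by simp only [f.map_act, AlexanderQuandle.val_act]; simp) α q
    refine ⟨AGL1.ofCocycle 1 (fun γ => (lk γ).toAdd * (f q).val) fun γ γ' => ?_, fun α => ?_⟩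
    · simp
      ring
    · simp [AGL1.ofCocycle, AlexanderQuandle.toConjAGL1_apply, h.lk_eq, hf]
  · have ht' : (1 - t : ℂ) ≠ 0 := by
      rw [sub_ne_zero]
      exact fun h => ht (Units.ext h.symm)
    -- The numerator is the translation part of the affine map by which `γ` changes the values of
    -- `f`. At `γ = μ α` it equals `(1 - t) f α`, whence the denominator.
    refine ⟨AGL1.ofCocycle (character lk t)
      (fun γ => ((f (γ • q)).val - character lk t γ * (f q).val) / (1 - t)) fun γ γ' => ?_,
      fun α => ?_⟩
    · have h1 := h.val_smul_sub f γ (γ' • q) q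
      rw [mul_smul, map_mul, Units.val_mul]
      field_simp
      linear_combination h1
    · simp only [AGL1.ofCocycle, AlexanderQuandle.toConjAGL1_apply, MonoidHom.mk'_apply]
      rw [h.character_apply, h.smul_eq, f.map_act, AlexanderQuandle.val_act]
      congr 1
      field_simp
      ring

/-- The quandle homomorphism `Q → A_t` of a representation `Γ → AGL₁` in the fibre over `t`. -/
noncomputable def restrict (h : MeridionalAction μ lk) {t : ℂˣ}
    (ρ : {ρ : Γ →* AGL1 | h.evalEquiv (alexanderFibration ρ) = t}) : Q →◃ AlexanderQuandle t where
  toFun α := ⟨AGL1.entry (ρ.1 (μ α)) 1 0⟩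
  map_act' := by
    intro α β
    have h1 : μ (α ◃ β) = (μ α : Γ) * μ β * (μ α : Γ)⁻¹ := μ.map_act
    have h2 : ∀ α, AGL1.mk (AGL1.entry (ρ.1 (μ α)) 1 0) t = ρ.1 (μ α) := fun α =>
      AGL1.mk_entry_of_diag_eq (h.mem_fibre_iff.1 ρ.2 α)
    refine AlexanderQuandle.toConjAGL1_injective t ?_
    refine Eq.trans ?_ (ShelfHom.map_act _).symm
    rw [Quandle.conj_act_eq_conj]
    simp only [AlexanderQuandle.toConjAGL1_apply, h2]
    rw [h1, map_mul, map_mul, map_inv]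

theorem toConjAGL1_restrict (h : MeridionalAction μ lk) {t : ℂˣ}
    (ρ : {ρ : Γ →* AGL1 | h.evalEquiv (alexanderFibration ρ) = t}) (α : Q) :
    AlexanderQuandle.toConjAGL1 t (h.restrict ρ α) = ρ.1 (μ α) :=
  AGL1.mk_entry_of_diag_eq (h.mem_fibre_iff.1 ρ.2 α)

/-- The fibre of the Alexander fibration as a quandle representation variety. -/
noncomputable def fibreEquiv (h : MeridionalAction μ lk) (t : ℂˣ) :
    (Q →◃ AlexanderQuandle t) ≃ {ρ : Γ →* AGL1 | h.evalEquiv (alexanderFibration ρ) = t} where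
  toFun f := ⟨(h.exists_hom f).choose, h.mem_fibre_iff.2 fun α => by
    rw [(h.exists_hom f).choose_spec]
    exact AGL1.diag_mk _ _⟩
  invFun := h.restrict
  left_inv f := DFunLike.ext _ _ fun α => AlexanderQuandle.toConjAGL1_injective t <| by
    rw [toConjAGL1_restrict]
    exact (h.exists_hom f).choose_spec α
  right_inv ρ := Subtype.ext <| h.hom_ext fun α =>
    ((h.exists_hom (h.restrict ρ)).choose_spec α).trans (h.toConjAGL1_restrict ρ α)

theorem fibreEquiv_apply (h : MeridionalAction μ lk) {t : ℂˣ} (f : Q →◃ AlexanderQuandle t)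
    (α : Q) : (h.fibreEquiv t f : Γ →* AGL1) (μ α) = AlexanderQuandle.toConjAGL1 t (f α) :=
  (h.exists_hom f).choose_spec α

/-- Write `γ` as a word in meridians. The lower left entry obeys the cocycle rule with coefficients
fixed on the fibre, so it is a linear combination of values of `f`. -/
theorem entry_fibreEquiv_mem (h : MeridionalAction μ lk) (t : ℂˣ) (γ : Γ) (i j : Fin 2) :
    (fun f => AGL1.entry ((h.fibreEquiv t f : Γ →* AGL1) γ) i j) ∈ quandleRegularFunctions Q t := by
  have const : ∀ c : ℂ, (fun _ => c) ∈ quandleRegularFunctions Q t :=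
    (quandleRegularFunctions Q t).algebraMap_mem
  have hdiag : ∀ γ f, AGL1.entry ((h.fibreEquiv t f : Γ →* AGL1) γ) 1 1 = character lk t γ :=
    fun γ f => congrArg Units.val (h.diag_apply (h.fibreEquiv t f).2 γ)
  have main : (fun f => AGL1.entry ((h.fibreEquiv t f : Γ →* AGL1) γ) 1 0) ∈
      quandleRegularFunctions Q t := by
    have hγ : γ ∈ Subgroup.closure (Set.range fun α => (μ α : Γ)) := by simp [h.closure_eq_top]
    induction hγ using Subgroup.closure_induction with
    | mem x hx =>
      obtain ⟨α, rfl⟩ := hx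
      simp only [fibreEquiv_apply, AlexanderQuandle.toConjAGL1_apply, AGL1.entry_one_zero_mk]
      exact Algebra.subset_adjoin ⟨α, rfl⟩
    | one =>
      have : AGL1.entry 1 1 0 = 0 := by simp [AGL1.entry]
      simpa only [map_one, this] using const 0
    | mul x y _ _ hx hy =>
      simp only [map_mul, AGL1.entry_mul, AGL1.entry_zero_zero, mul_one, hdiag]
      exact add_mem hx (mul_mem (const _) hy)
    | inv x _ hx =>
      simp only [map_inv, AGL1.entry_inv_one_zero, h.diag_apply (h.fibreEquiv t _).2]
      exact mul_mem (const _) hx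
  fin_cases i <;> fin_cases j
  · simpa only [Fin.zero_eta, AGL1.entry_zero_zero] using const 1
  · simpa only [Fin.zero_eta, Fin.mk_one, AGL1.entry_zero_one] using const 0
  · exact main
  · simpa only [Fin.mk_one, hdiag] using const _

/-- Both algebras match on generators: matrix entries are regular in `f` by `entry_fibreEquiv_mem`,
and `f α` is the lower left entry at `μ α`. -/
theorem isRegularOn_iff (h : MeridionalAction μ lk) (t : ℂˣ)
    (u : {ρ : Γ →* AGL1 | h.evalEquiv (alexanderFibration ρ) = t} → ℂ) :
    IsRegularOn {ρ : Γ →* AGL1 | h.evalEquiv (alexanderFibration ρ) = t} u ↔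
      (fun f => u (h.fibreEquiv t f)) ∈ quandleRegularFunctions Q t := by
  constructor
  · rintro ⟨v, hv, huv⟩
    simp only [huv]
    clear huv
    induction hv using Algebra.adjoin_induction with
    | mem x hx =>
      obtain ⟨γ, i, j, rfl⟩ := hx
      exact h.entry_fibreEquiv_mem t γ i j
    | algebraMap r => exact (quandleRegularFunctions Q t).algebraMap_mem r
    | add x y _ _ hx hy => exact add_mem hx hy
    | mul x y _ _ hx hy => exact mul_mem hx hy
  · intro hu
    suffices H : ∀ w ∈ quandleRegularFunctions Q t, ∃ v ∈ groupRegularFunctions Γ,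
        ∀ f, w f = v (h.fibreEquiv t f : Γ →* AGL1) by
      obtain ⟨v, hv, huv⟩ := H _ hu
      refine ⟨v, hv, fun ρ => ?_⟩
      simpa using huv ((h.fibreEquiv t).symm ρ)
    intro w hw
    induction hw using Algebra.adjoin_induction with
    | mem x hx =>
      obtain ⟨α, rfl⟩ := hx
      refine ⟨_, Algebra.subset_adjoin ⟨(μ α : Γ), 1, 0, rfl⟩, fun f => ?_⟩
      rw [fibreEquiv_apply, AlexanderQuandle.toConjAGL1_apply, AGL1.entry_one_zero_mk]
    | algebraMap r => exact ⟨_, (groupRegularFunctions Γ).algebraMap_mem r, fun _ => rfl⟩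
    | add x y _ _ hx hy =>
      obtain ⟨v, hv, h1⟩ := hx
      obtain ⟨v', hv', h2⟩ := hy
      exact ⟨_, add_mem hv hv', fun f => by simp [h1, h2]⟩
    | mul x y _ _ hx hy =>
      obtain ⟨v, hv, h1⟩ := hx
      obtain ⟨v', hv', h2⟩ := hy
      exact ⟨_, mul_mem hv hv', fun f => by simp [h1, h2]⟩

end MeridionalAction

/-! ### Path functionals -/

/-- A functor from the fundamental groupoid of `X` to the group `G`. -/
structure PathHolonomy (X : Type*) [TopologicalSpace X] (G : Type*) [Group G] where
  val : ∀ {x y : X}, Path x y → G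
  val_trans : ∀ {x y z : X} (p : Path x y) (q : Path y z), val (p.trans q) = val p * val q
  val_eq_of_homotopic : ∀ {x y : X} {p q : Path x y}, p.Homotopic q → val p = val q

namespace PathHolonomy

variable {X Y G : Type*} [TopologicalSpace X] [TopologicalSpace Y] [Group G]

theorem val_refl (H : PathHolonomy X G) (x : X) : H.val (Path.refl x) = 1 := by
  have h := H.val_trans (Path.refl x) (Path.refl x)
  rw [H.val_eq_of_homotopic (Path.Homotopic.refl_trans (Path.refl x))] at h
  exact left_eq_mul.1 h

theorem val_symm (H : PathHolonomy X G) {x y : X} (p : Path x y) : H.val p.symm = (H.val p)⁻¹ := by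
  rw [eq_inv_iff_mul_eq_one, ← H.val_trans, ← H.val_refl y]
  exact H.val_eq_of_homotopic (Path.Homotopic.symm_trans p)

/-- Compares paths whose endpoints agree only propositionally. -/
theorem val_congr (H : PathHolonomy X G) {x y x' y' : X} (p : Path x y) (q : Path x' y')
    (h : ∀ s, p s = q s) : H.val p = H.val q := by
  obtain rfl : x = x' := by simpa using h 0
  obtain rfl : y = y' := by simpa using h 1
  rw [Path.ext (funext h)]

/-- Precomposition with a continuous map. -/
def comap (H : PathHolonomy X G) (f : C(Y, X)) : PathHolonomy Y G where
  val p := H.val (p.map f.continuous)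
  val_trans p q := by rw [Path.map_trans, H.val_trans]
  val_eq_of_homotopic h := H.val_eq_of_homotopic (h.map f)

theorem comap_val (H : PathHolonomy X G) (f : C(Y, X)) {x y : Y} (p : Path x y) :
    (H.comap f).val p = H.val (p.map f.continuous) := rfl

/-- Integrate from a base point; the choice of path is immaterial. -/
theorem exists_potential [SimplyConnectedSpace X] (H : PathHolonomy X G) :
    ∃ c : X → G, ∀ {x y : X} (p : Path x y), H.val p = (c x)⁻¹ * c y := by
  obtain ⟨b⟩ : Nonempty X := inferInstance
  refine ⟨fun x => H.val (PathConnectedSpace.somePath b x), fun {x y} p => ?_⟩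
  rw [eq_inv_mul_iff_mul_eq, ← H.val_trans]
  exact H.val_eq_of_homotopic (SimplyConnectedSpace.paths_homotopic _ _)

/-- A function that is a potential near each point of a path is a potential along the path. -/
theorem val_eq_of_locally (H : PathHolonomy X G) {x y : X} (p : Path x y) (c : X → G)
    (h : ∀ s : I, ∃ W ∈ nhds s, ∀ {a b : I} (r : Path a b), Set.range r ⊆ W →
      H.val (r.map p.continuous) = (c (p a))⁻¹ * c (p b)) :
    H.val p = (c x)⁻¹ * c y := by
  have : ContractibleSpace I := (convex_Icc (0 : ℝ) 1).contractibleSpace ⟨0, by simp⟩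
  obtain ⟨k, hk⟩ := (H.comap (p : C(I, X))).exists_potential
  -- On the interval the pulled-back functional has a global potential `k`. Locally `c ∘ p` is
  -- another, so their ratio is locally constant, hence constant.
  have hloc : IsLocallyConstant fun s : I => c (p s) * (k s)⁻¹ := by
    rw [IsLocallyConstant.iff_eventually_eq]
    intro s
    obtain ⟨W, hW, hr⟩ := h s
    obtain ⟨ε, hε, hεW⟩ := Metric.mem_nhds_iff.1 hW
    filter_upwards [Metric.ball_mem_nhds s hε] with s' hs'
    let r : Path s s' :=
      { toFun := fun u => ⟨AffineMap.lineMap (s : ℝ) (s' : ℝ) (u : ℝ),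
          (convex_Icc (0 : ℝ) 1).lineMap_mem s.2 s'.2 u.2⟩
        continuous_toFun := by fun_prop
        source' := by simp
        target' := by simp }
    have h1 := hr r (by
      rintro _ ⟨u, rfl⟩
      exact hεW ((convex_ball (s : ℝ) ε).lineMap_mem (Metric.mem_ball_self hε) hs' u.2))
    have h2 := hk r
    rw [comap_val] at h2
    have h3 := h1.symm.trans h2
    rw [inv_mul_eq_iff_eq_mul] at h3
    rw [h3]
    group
  have h01 := hloc.apply_eq_of_isPreconnected isPreconnected_univ (Set.mem_univ 0) (Set.mem_univ 1)
  let ι : Path (0 : I) 1 := ⟨ContinuousMap.id I, rfl, rfl⟩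
  have h2 := hk ι
  rw [comap_val] at h2
  have h3 : H.val p = H.val (ι.map (p : C(I, X)).continuous) := H.val_congr _ _ fun _ => rfl
  rw [h3, h2]
  simp only [Path.source, Path.target] at h01
  rw [mul_inv_eq_iff_eq_mul] at h01
  rw [h01]
  group

end PathHolonomy

/-! ### The winding number -/

namespace Circle

theorem lift_one_sub_lift_zero_eq {p : I → Circle} {f g : C(I, ℝ)}
    (hf : ∀ s, Circle.exp (f s) = p s) (hg : ∀ s, Circle.exp (g s) = p s) :
    f 1 - f 0 = g 1 - g 0 := by
  obtain ⟨m, hm⟩ := Circle.exp_eq_exp.1 ((hf 0).trans (hg 0).symm)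
  have h := (Circle.isCoveringMap_exp).eq_of_comp_eq (g₁ := f)
    (g₂ := fun s => g s + m * (2 * Real.pi)) f.continuous (by fun_prop)
    (funext fun s => (hf s).trans ((hg s).symm.trans (Circle.exp_eq_exp.2 ⟨-m, by push_cast; ring⟩)))
    0 hm
  have h1 := congrFun h 1
  linarith

theorem exists_lift {x y : Circle} (p : Path x y) :
    ∃ f : C(I, ℝ), ∀ s, Circle.exp (f s) = p s := by
  obtain ⟨θ, hθ⟩ := Circle.exp_surjective x
  obtain ⟨f, hf, -⟩ := Circle.isCoveringMap_exp.exists_path_lifts (p : C(I, Circle)) θ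
    (by simp [hθ])
  exact ⟨f, congrFun hf⟩

/-- The angle swept by a path in the circle. -/
noncomputable def sweptAngle {x y : Circle} (p : Path x y) : ℝ :=
  (exists_lift p).choose 1 - (exists_lift p).choose 0

theorem sweptAngle_eq {x y : Circle} {p : Path x y} (f : C(I, ℝ))
    (hf : ∀ s, Circle.exp (f s) = p s) : sweptAngle p = f 1 - f 0 :=
  lift_one_sub_lift_zero_eq (exists_lift p).choose_spec hf

/-- The swept angle as a functor on the fundamental groupoid. -/
noncomputable def windingHolonomy : PathHolonomy Circle (Multiplicative ℝ) where
  val p := Multiplicative.ofAdd (sweptAngle p)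
  val_trans {x y z} p q := by
    obtain ⟨f, hf⟩ := exists_lift p
    obtain ⟨g, hg⟩ := exists_lift q
    have h01 : Circle.exp (g 0) = Circle.exp (f 1) := by rw [hf, hg]; simp
    obtain ⟨m, hm⟩ := Circle.exp_eq_exp.1 h01
    let P : Path (f 0) (f 1) := ⟨f, rfl, rfl⟩
    -- The lift of `q` is shifted by a multiple of `2π` so that it starts where the lift of `p`
    -- ends.
    let Q : Path (f 1) (g 1 - m * (2 * Real.pi)) :=
      ⟨⟨fun s => g s - m * (2 * Real.pi), by fun_prop⟩, by simp [hm], rfl⟩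
    rw [sweptAngle_eq f hf, sweptAngle_eq g hg, sweptAngle_eq (P.trans Q : C(I, ℝ)), ← ofAdd_add]
    · congr 1
      simp [hm]
      ring
    · intro s
      simp only [ContinuousMap.coe_coe, Path.trans_apply]
      split_ifs
      · exact hf _
      · exact (Circle.exp_eq_exp.2 ⟨-m, by simp [Q]; ring⟩).trans (hg _)
  val_eq_of_homotopic {x y p q} h := by
    obtain ⟨θ, hθ⟩ := Circle.exp_surjective x
    have hp : (p : C(I, Circle)) 0 = Circle.exp θ := by simp [hθ]
    have hq : (q : C(I, Circle)) 0 = Circle.exp θ := by simp [hθ]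
    have key := Circle.isCoveringMap_exp.liftPath_apply_one_eq_of_homotopicRel h θ hp hq
    rw [sweptAngle_eq (Circle.isCoveringMap_exp.liftPath _ θ hp)
        (congrFun (Circle.isCoveringMap_exp.liftPath_lifts _ θ hp)),
      sweptAngle_eq (Circle.isCoveringMap_exp.liftPath _ θ hq)
        (congrFun (Circle.isCoveringMap_exp.liftPath_lifts _ θ hq)),
      Circle.isCoveringMap_exp.liftPath_zero, Circle.isCoveringMap_exp.liftPath_zero]
    exact congrArg (fun a => Multiplicative.ofAdd (a - θ)) key

end Circle

/-! ### Trivializations of torsors over cubes -/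

section Torsor

variable {ι X G : Type*} [TopologicalSpace X] [Group G] [TopologicalSpace G]

/-- `s` is a section over `A` of the torsor with local sections `c i` over `B i`. -/
def IsTorsorSection (B : ι → Set X) (c : ι → X → G) (A : Set X) (s : X → G) : Prop :=
  ∀ i, ContinuousOn (fun x => s x * (c i x)⁻¹) (B i ∩ A)

variable {n : Type*} [DecidableEq n] [IsTopologicalGroup G]
  {B : ι → Set (n → ℝ)} {c : ι → (n → ℝ) → G}

/-- On the common face the two sections differ by a continuous left factor, because the `c i`
cancel. Extend this factor constantly in direction `k` and use it to correct `s'`. -/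
theorem IsTorsorSection.glue (hB : ∀ i, IsOpen (B i)) {A : Set (n → ℝ)} (hA : A ⊆ ⋃ i, B i) (k : n)
    (m : ℝ) (hm : ∀ x ∈ A, m ≤ x k → Function.update x k m ∈ A) {s s' : (n → ℝ) → G}
    (hs : IsTorsorSection B c (A ∩ {x | x k ≤ m}) s)
    (hs' : IsTorsorSection B c (A ∩ {x | m ≤ x k}) s') :
    ∃ s'', IsTorsorSection B c A s'' := by
  classical
  let ρ : (n → ℝ) → n → ℝ := fun x => Function.update x k m
  have hρ : Continuous ρ := by fun_prop
  have hface : ContinuousOn (fun x => s x * (s' x)⁻¹) (A ∩ {x | x k = m}) := by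
    intro x hx
    obtain ⟨i, hi⟩ := Set.mem_iUnion.1 (hA hx.1)
    have h1 : ContinuousWithinAt (fun x => s x * (c i x)⁻¹) (B i ∩ (A ∩ {x | x k = m})) x :=
      (hs i x ⟨hi, hx.1, le_of_eq hx.2⟩).mono fun y hy => ⟨hy.1, hy.2.1, le_of_eq hy.2.2⟩
    have h2 : ContinuousWithinAt (fun x => s' x * (c i x)⁻¹) (B i ∩ (A ∩ {x | x k = m})) x :=
      (hs' i x ⟨hi, hx.1, ge_of_eq hx.2⟩).mono fun y hy => ⟨hy.1, hy.2.1, ge_of_eq hy.2.2⟩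
    have h3 := h1.mul h2.inv
    rw [Set.inter_comm, continuousWithinAt_inter ((hB i).mem_nhds hi)] at h3
    refine h3.congr_of_eventuallyEq (.of_forall fun y => ?_) ?_ <;> simp
  let h : (n → ℝ) → G := fun x => s (ρ x) * (s' (ρ x))⁻¹
  have hh : ContinuousOn h (A ∩ {x | m ≤ x k}) :=
    hface.comp hρ.continuousOn fun x hx => ⟨hm x hx.1 hx.2, by simp [ρ]⟩
  refine ⟨fun x => if x k ≤ m then s x else h x * s' x, fun i => ?_⟩
  have hsplit : B i ∩ A = (B i ∩ (A ∩ {x | x k ≤ m})) ∪ (B i ∩ (A ∩ {x | m ≤ x k})) := by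
    ext x
    have := le_total (x k) m
    simp only [Set.mem_inter_iff, Set.mem_union, Set.mem_ofPred_eq]
    tauto
  have h1 : ContinuousOn (fun x => (if x k ≤ m then s x else h x * s' x) * (c i x)⁻¹)
      (B i ∩ (A ∩ {x | x k ≤ m})) :=
    (hs i).congr fun x hx => by
      have := hx.2.2
      simp only [Set.mem_ofPred_eq] at this
      simp [this]
  have h2 : ContinuousOn (fun x => (if x k ≤ m then s x else h x * s' x) * (c i x)⁻¹)
      (B i ∩ (A ∩ {x | m ≤ x k})) := by
    refine ((hh.mono Set.inter_subset_right).mul (hs' i)).congr fun x hx => ?_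
    by_cases hxm : x k ≤ m
    · have : x k = m := le_antisymm hxm hx.2.2
      have h4 : ρ x = x := by simp [ρ, ← this]
      simp [h, h4, hxm]
    · simp [hxm, mul_assoc]
  have hc1 : IsClosed {x : n → ℝ | x k ≤ m} := isClosed_le (by fun_prop) (by fun_prop)
  have hc2 : IsClosed {x : n → ℝ | m ≤ x k} := isClosed_le (by fun_prop) (by fun_prop)
  intro x hx
  rw [hsplit, continuousWithinAt_union]
  constructor
  · by_cases hxm : x ∈ {x : n → ℝ | x k ≤ m}
    · exact h1 x ⟨hx.1, hx.2, hxm⟩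
    · refine continuousWithinAt_of_notMem_closure fun hcl => hxm ?_
      exact closure_minimal (fun y hy => hy.2.2) hc1 hcl
  · by_cases hxm : x ∈ {x : n → ℝ | m ≤ x k}
    · exact h2 x ⟨hx.1, hx.2, hxm⟩
    · refine continuousWithinAt_of_notMem_closure fun hcl => hxm ?_
      exact closure_minimal (fun y hy => hy.2.2) hc2 hcl

/-- A torsor over a box is trivial. -/
theorem exists_isTorsorSection_Icc [Fintype n] (hB : ∀ i, IsOpen (B i))
    (hc : ∀ i j, ContinuousOn (fun x => c i x * (c j x)⁻¹) (B i ∩ B j)) (a b : n → ℝ)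
    (hab : Set.Icc a b ⊆ ⋃ i, B i) : ∃ s, IsTorsorSection B c (Set.Icc a b) s := by
  obtain ⟨δ, hδ, hL⟩ := lebesgue_number_lemma_of_metric isCompact_Icc hB hab
  -- `S` lists the directions in which the box may be longer than the Lebesgue number. With `S`
  -- empty the box lies in a single `B i`.
  suffices H : ∀ (S : Finset n) (a' b' : n → ℝ), a ≤ a' → b' ≤ b → a' ≤ b' →
      (∀ k ∉ S, b' k - a' k < δ) → ∃ s, IsTorsorSection B c (Set.Icc a' b') s by
    by_cases h : a ≤ b
    · exact H Finset.univ a b le_rfl le_rfl h (by simp)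
    · rw [Set.Icc_eq_empty h]
      exact ⟨1, fun i => by simp⟩
  intro S
  induction S using Finset.induction_on with
  | empty =>
    intro a' b' ha hb hab' hw
    obtain ⟨i, hi⟩ := hL a' ⟨ha, hab'.trans hb⟩
    refine ⟨c i, fun j => (hc i j).mono fun x hx => ⟨hi ?_, hx.1⟩⟩
    rw [Metric.mem_ball, dist_pi_lt_iff hδ]
    intro k
    have := hw k (Finset.notMem_empty k)
    have h1 := hx.2.1 k
    have h2 := hx.2.2 k
    rw [Real.dist_eq, abs_of_nonneg (by linarith)]
    linarith
  | insert k S hk ih =>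
    have step : ∀ (N : ℕ) (a' b' : n → ℝ), a ≤ a' → b' ≤ b → a' ≤ b' →
        (∀ l ∉ insert k S, b' l - a' l < δ) → b' k - a' k < δ + N * (δ / 2) →
        ∃ s, IsTorsorSection B c (Set.Icc a' b') s := by
      intro N
      induction N with
      | zero =>
        intro a' b' ha hb hab' hw hk'
        refine ih a' b' ha hb hab' fun l hl => ?_
        by_cases hlk : l = k
        · subst hlk
          simpa using hk'
        · exact hw l (by simp [hlk, hl])
      | succ N ihN =>
        intro a' b' ha hb hab' hw hk'
        by_cases hsmall : b' k - a' k < δ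
        · exact ihN a' b' ha hb hab' hw (by nlinarith)
        · push Not at hsmall
          -- Cut off a slab of thickness `δ / 2 < δ`, which is short in direction `k`; the rest
          -- needs one step fewer.
          set m := a' k + δ / 2 with hm
          have e1 : Set.Icc a' b' ∩ {x | x k ≤ m} = Set.Icc a' (Function.update b' k m) := by
            ext x
            simp only [Set.mem_inter_iff, Set.mem_Icc, Set.mem_ofPred_eq, le_update_iff]
            constructor
            · rintro ⟨⟨h1, h2⟩, h3⟩
              exact ⟨h1, h3, fun l _ => h2 l⟩
            · rintro ⟨h1, h3, h2⟩
              refine ⟨⟨h1, fun l => ?_⟩, h3⟩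
              by_cases hlk : l = k
              · subst hlk; linarith
              · exact h2 l hlk
          have e2 : Set.Icc a' b' ∩ {x | m ≤ x k} = Set.Icc (Function.update a' k m) b' := by
            ext x
            simp only [Set.mem_inter_iff, Set.mem_Icc, Set.mem_ofPred_eq, update_le_iff]
            constructor
            · rintro ⟨⟨h1, h2⟩, h3⟩
              exact ⟨⟨h3, fun l _ => h1 l⟩, h2⟩
            · rintro ⟨⟨h3, h1⟩, h2⟩
              refine ⟨⟨fun l => ?_, h2⟩, h3⟩
              by_cases hlk : l = k
              · subst hlk; linarith
              · exact h1 l hlk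
          obtain ⟨s, hs⟩ := ih a' (Function.update b' k m) ha
            (update_le_iff.2 ⟨by linarith [hb k], fun l _ => hb l⟩)
            (le_update_iff.2 ⟨by linarith, fun l _ => hab' l⟩) (fun l hl => by
              by_cases hlk : l = k
              · subst hlk
                simp [hm, hδ]
              · simpa [hlk] using hw l (by simp [hlk, hl]))
          obtain ⟨s', hs'⟩ := ihN (Function.update a' k m) b'
            (le_update_iff.2 ⟨by linarith [ha k], fun l _ => ha l⟩) hb
            (update_le_iff.2 ⟨by linarith, fun l _ => hab' l⟩) (fun l hl => by
              have hlk : l ≠ k := fun h => hl (by simp [h])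
              simpa [hlk] using hw l hl) (by
              simp only [Function.update_self, hm]
              push_cast at hk'
              linarith)
          rw [← e1] at hs
          rw [← e2] at hs'
          refine IsTorsorSection.glue hB ((Set.Icc_subset_Icc ha hb).trans hab) k m ?_ hs hs'
          intro x hx _
          refine ⟨le_update_iff.2 ⟨by linarith, fun l _ => hx.1 l⟩,
            update_le_iff.2 ⟨by linarith, fun l _ => hx.2 l⟩⟩
    intro a' b' ha hb hab' hw
    obtain ⟨N, hN⟩ := exists_nat_gt ((b' k - a' k) / (δ / 2))
    refine step N a' b' ha hb hab' hw ?_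
    rw [div_lt_iff₀ (by positivity)] at hN
    linarith

end Torsor

/-! ### The three-sphere as a quotient of a cube -/

/-- `q` maps the unit ball onto the sphere, collapsing its boundary and everything outside to `v`;
it is injective on the open ball, and the cube contains the ball. -/
theorem S3.exists_cube_parametrization (v : S3) :
    ∃ (q : C(Fin 3 → ℝ, S3)) (sec : S3 → Fin 3 → ℝ), ContinuousOn sec {v}ᶜ ∧
      ∀ x ≠ v, sec x ∈ Set.Icc (-1) 1 ∧ q (sec x) = x := by
  have : Fact (Module.finrank ℝ (EuclideanSpace ℝ (Fin 4)) = 3 + 1) := ⟨by simp⟩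
  have hv : ‖(v : EuclideanSpace ℝ (Fin 4))‖ = 1 := by simp
  have hv0 : (v : EuclideanSpace ℝ (Fin 4)) ≠ 0 := fun h => by simp [h] at hv
  let W := (ℝ ∙ (v : EuclideanSpace ℝ (Fin 4)))ᗮ
  let L : EuclideanSpace ℝ (Fin 3) ≃ₗᵢ[ℝ] W :=
    (OrthonormalBasis.fromOrthogonalSpanSingleton 3 hv0).repr.symm
  have horth : ∀ w : W, inner ℝ (w : EuclideanSpace ℝ (Fin 4)) (v : EuclideanSpace ℝ (Fin 4)) = 0 :=
    fun w => by
      rw [real_inner_comm]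
      exact Submodule.mem_orthogonal_singleton_iff_inner_right.1 w.2
  have hnorm : ∀ (w : W) (r : ℝ), ‖(w : EuclideanSpace ℝ (Fin 4)) + r • v.1‖ ^ 2 = ‖w‖ ^ 2 + r ^ 2 := by
    intro w r
    rw [norm_add_sq_real, inner_smul_right, horth, norm_smul, hv]
    simp
  -- With `r = ‖y‖ ^ 2 ≤ 1` this has unit norm since `4 (1 - r) r + (2 r - 1) ^ 2 = 1`. For `r ≥ 1`
  -- the root is `0` by convention and the minimum is `1`, giving `v`.
  let q₀ : (Fin 3 → ℝ) → EuclideanSpace ℝ (Fin 4) := fun y =>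
    ((2 * √(1 - ‖WithLp.toLp 2 y‖ ^ 2)) • L (WithLp.toLp 2 y) : W) +
      (min (2 * ‖WithLp.toLp 2 y‖ ^ 2 - 1) 1) • v.1
  have hq₀ : ∀ y, q₀ y ∈ Metric.sphere (0 : EuclideanSpace ℝ (Fin 4)) 1 := by
    intro y
    rw [mem_sphere_zero_iff_norm, ← sq_eq_sq₀ (norm_nonneg _) zero_le_one, hnorm, norm_smul,
      L.norm_map, mul_pow, Real.norm_eq_abs, sq_abs, mul_pow]
    rcases le_total (‖WithLp.toLp 2 y‖ ^ 2) 1 with h | h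
    · rw [Real.sq_sqrt (by linarith), min_eq_left (by linarith)]
      ring
    · rw [Real.sqrt_eq_zero_of_nonpos (by linarith), min_eq_right (by linarith)]
      ring
  have hcont : Continuous q₀ := by fun_prop
  let ip : S3 → ℝ := fun x => inner ℝ (v : EuclideanSpace ℝ (Fin 4)) x.1
  let pr : S3 → W := fun x => ⟨x.1 - ip x • v.1, by
    refine Submodule.mem_orthogonal_singleton_iff_inner_right.2 ?_
    rw [inner_sub_right, inner_smul_right, real_inner_self_eq_norm_sq, hv]
    simp [ip]⟩
  let sec : S3 → Fin 3 → ℝ := fun x => WithLp.ofLp ((√(2 * (1 - ip x)))⁻¹ • L.symm (pr x))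
  have hip : ∀ x ≠ v, ip x < 1 := fun x hx => by
    refine inner_lt_one_iff_real_of_norm_eq_one hv (by simp) |>.2 fun h => hx ?_
    exact Subtype.ext h.symm
  have hdec : ∀ x : S3, (x : EuclideanSpace ℝ (Fin 4)) = pr x + ip x • v.1 :=
    fun x => (sub_add_cancel _ _).symm
  have hpr : ∀ x, ‖pr x‖ ^ 2 = 1 - ip x ^ 2 := by
    intro x
    have h1 := hnorm (pr x) (ip x)
    rw [← hdec, show ‖x.1‖ = 1 by simp] at h1
    linarith
  refine ⟨⟨fun y => ⟨q₀ y, hq₀ y⟩, by fun_prop⟩, sec, ?_, ?_⟩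
  · have hip_c : Continuous ip := by fun_prop
    have hpr_c : Continuous pr := by fun_prop
    have h1 : ContinuousOn (fun x => (√(2 * (1 - ip x)))⁻¹) {v}ᶜ := by
      refine ContinuousOn.inv₀ (by fun_prop) fun x hx => ?_
      have := hip x hx
      exact (Real.sqrt_pos.2 (by linarith)).ne'
    have h2 : ContinuousOn (fun x => (√(2 * (1 - ip x)))⁻¹ • L.symm (pr x)) {v}ᶜ :=
      h1.smul (by fun_prop)
    exact (PiLp.continuous_ofLp 2 _).comp_continuousOn h2
  · intro x hx
    have h1 := hip x hx
    have h2 : -1 ≤ ip x := by nlinarith [hpr x, sq_nonneg ‖pr x‖]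
    have h3 : ‖WithLp.toLp 2 (sec x)‖ ^ 2 = (1 + ip x) / 2 := by
      simp only [sec, WithLp.toLp_ofLp]
      rw [norm_smul, L.symm.norm_map, mul_pow, hpr, norm_inv, Real.norm_eq_abs, inv_pow, sq_abs,
        Real.sq_sqrt (by linarith)]
      have : 1 - ip x ≠ 0 := by linarith
      field_simp
      ring
    constructor
    · have h4 : ‖WithLp.toLp 2 (sec x)‖ ≤ 1 := by
        nlinarith [norm_nonneg (WithLp.toLp 2 (sec x))]
      have h5 : ∀ i, |sec x i| ≤ 1 := fun i =>
        (PiLp.norm_apply_le (WithLp.toLp 2 (sec x)) i).trans h4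
      exact ⟨fun i => (abs_le.1 (h5 i)).1, fun i => (abs_le.1 (h5 i)).2⟩
    · refine Subtype.ext ?_
      change q₀ (sec x) = x
      rw [hdec x]
      simp only [q₀]
      rw [h3, min_eq_left (by linarith)]
      congr 2
      · have h6 : √(2 * (1 - ip x)) ≠ 0 := (Real.sqrt_pos.2 (by linarith)).ne'
        have h7 : 2 * √(1 - (1 + ip x) / 2) = √(2 * (1 - ip x)) := by
          rw [show 1 - (1 + ip x) / 2 = (2 * (1 - ip x)) / 2 ^ 2 by ring,
            Real.sqrt_div (by linarith), Real.sqrt_sq (by norm_num)]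
          ring
        simp only [sec, WithLp.toLp_ofLp]
        rw [h7, map_smul, smul_smul, mul_inv_cancel₀ h6, one_smul, L.apply_symm_apply]
      · ring

namespace TubularNeighbourhood

variable {K : Knot} (N : TubularNeighbourhood K)

/-! ### Coordinates in the tube -/

/-- The coordinates in the tubular neighbourhood. -/
noncomputable def coord : S3 → Circle × ℂ :=
  haveI : Nonempty (Circle × ℂ) := ⟨(1, 0)⟩
  Function.invFun N.tube

@[simp] theorem coord_tube (p : Circle × ℂ) : N.coord (N.tube p) = p :=
  Function.leftInverse_invFun N.isOpenEmbedding_tube.injective p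

theorem continuousAt_coord (p : Circle × ℂ) : ContinuousAt N.coord (N.tube p) := by
  rw [← N.isOpenEmbedding_tube.continuousAt_iff]
  exact continuousAt_id.congr (.of_forall fun p => (N.coord_tube p).symm)

theorem tube_mem_range_curve {p : Circle × ℂ} : N.tube p ∈ Set.range K.curve ↔ p.2 = 0 := by
  constructor
  · rintro ⟨z, hz⟩
    rw [← N.tube_core z] at hz
    rw [← N.isOpenEmbedding_tube.injective hz]
  · intro h
    exact ⟨p.1, by rw [← N.tube_core, ← h]⟩

/-- The point of the complement with the given coordinates. -/
noncomputable def tubeCompl (p : Circle × ℂ) (h : p.2 ≠ 0) : K.Complement :=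
  ⟨N.tube p, fun h' => h (N.tube_mem_range_curve.1 h')⟩

theorem isClosed_closedTube : IsClosed (N.tube '' {p | ‖p.2‖ ≤ 1}) := by
  have h : {p : Circle × ℂ | ‖p.2‖ ≤ 1} = Set.univ ×ˢ Metric.closedBall 0 1 := by
    ext p
    simp
  rw [h]
  exact ((isCompact_univ.prod (isCompact_closedBall _ _)).image
    N.isOpenEmbedding_tube.continuous).isClosed

theorem isOpen_openTube : IsOpen (N.tube '' {p | ‖p.2‖ < 1}) :=
  N.isOpenEmbedding_tube.isOpenMap _ (isOpen_lt (by fun_prop) (by fun_prop))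

theorem openTube_subset_closedTube : N.tube '' {p | ‖p.2‖ < 1} ⊆ N.tube '' {p | ‖p.2‖ ≤ 1} :=
  Set.image_mono fun p (hp : ‖p.2‖ < 1) => hp.le

/-! ### The complement deformation retracts onto the exterior -/

/-- The radial push from `ℂ^*` to the complement of the open unit disc. -/
noncomputable def radial (τ : ℝ) (w : ℂ) : ℂ := (((1 - τ) + τ / min 1 ‖w‖ : ℝ) : ℂ) * w

theorem radial_zero (w : ℂ) : radial 0 w = w := by simp [radial]

theorem radial_of_one_le (τ : ℝ) {w : ℂ} (hw : 1 ≤ ‖w‖) : radial τ w = w := by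
  simp [radial, hw]

theorem radial_ne_zero {τ : ℝ} (hτ : τ ∈ I) {w : ℂ} (hw : w ≠ 0) : radial τ w ≠ 0 := by
  have h : 0 < min 1 ‖w‖ := lt_min one_pos (norm_pos_iff.2 hw)
  have h1 : (1 - τ) + τ / min 1 ‖w‖ ≠ 0 := by
    rcases hτ.1.eq_or_lt with h0 | h0
    · simp [← h0]
    · have := div_pos h0 h
      linarith [hτ.2]
  exact mul_ne_zero (Complex.ofReal_ne_zero.2 h1) hw

theorem one_le_norm_radial_one {w : ℂ} (hw : w ≠ 0) : 1 ≤ ‖radial 1 w‖ := by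
  have h0 := norm_pos_iff.2 hw
  have h : 0 < min 1 ‖w‖ := lt_min one_pos h0
  rw [radial, norm_mul, Complex.norm_real, Real.norm_of_nonneg (by positivity)]
  rw [sub_self, zero_add, one_div, ← div_eq_inv_mul, one_le_div h]
  exact min_le_right _ _

theorem continuousAt_radial {p : ℝ × ℂ} (hp : p.2 ≠ 0) :
    ContinuousAt (fun p : ℝ × ℂ => radial p.1 p.2) p := by
  have h : min 1 ‖p.2‖ ≠ 0 := (lt_min one_pos (norm_pos_iff.2 hp)).ne'
  have h1 : ContinuousAt (fun p : ℝ × ℂ => (1 - p.1) + p.1 / min 1 ‖p.2‖) p :=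
    ContinuousAt.add (by fun_prop) (ContinuousAt.div (by fun_prop) (by fun_prop) h)
  exact (Complex.continuous_ofReal.continuousAt.comp h1).mul continuousAt_snd

open Classical in
/-- The deformation of the knot complement, as a map to the sphere. -/
noncomputable def pushAux (τ : ℝ) (x : S3) : S3 :=
  if x ∈ Set.range N.tube then N.tube ((N.coord x).1, radial τ (N.coord x).2) else x

theorem pushAux_tube (τ : ℝ) (p : Circle × ℂ) :
    N.pushAux τ (N.tube p) = N.tube (p.1, radial τ p.2) := by
  simp [pushAux]

theorem pushAux_eq_self (τ : ℝ) {x : S3} (hx : x ∉ N.tube '' {p | ‖p.2‖ < 1}) :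
    N.pushAux τ x = x := by
  by_cases h : x ∈ Set.range N.tube
  · obtain ⟨p, rfl⟩ := h
    have : 1 ≤ ‖p.2‖ := not_lt.1 fun h => hx ⟨p, h, rfl⟩
    rw [pushAux_tube, radial_of_one_le _ this]
  · simp [pushAux, h]

theorem pushAux_zero (x : S3) : N.pushAux 0 x = x := by
  by_cases h : x ∈ Set.range N.tube
  · obtain ⟨p, rfl⟩ := h
    rw [pushAux_tube, radial_zero]
  · simp [pushAux, h]

theorem pushAux_notMem {τ : ℝ} (hτ : τ ∈ I) {x : S3} (hx : x ∉ Set.range K.curve) :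
    N.pushAux τ x ∉ Set.range K.curve := by
  by_cases h : x ∈ Set.range N.tube
  · obtain ⟨p, rfl⟩ := h
    rw [tube_mem_range_curve] at hx
    rw [pushAux_tube, tube_mem_range_curve]
    exact radial_ne_zero hτ hx
  · simpa [pushAux, h] using hx

theorem pushAux_one_notMem {x : S3} (hx : x ∉ Set.range K.curve) :
    N.pushAux 1 x ∉ N.tube '' {p | ‖p.2‖ < 1} := by
  by_cases h : x ∈ Set.range N.tube
  · obtain ⟨p, rfl⟩ := h
    rw [tube_mem_range_curve] at hx
    rw [pushAux_tube, N.isOpenEmbedding_tube.injective.mem_set_image]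
    exact not_lt.2 (one_le_norm_radial_one hx)
  · have : N.pushAux 1 x = x := by simp [pushAux, h]
    rw [this]
    rintro ⟨p, -, rfl⟩
    exact h ⟨p, rfl⟩

/-- In the open collared tube use coordinates. A point outside it is off the compact solid torus,
near which the map is the identity. -/
theorem continuousAt_pushAux (τ : ℝ) {x : S3} (hx : x ∉ Set.range K.curve) :
    ContinuousAt (fun y : ℝ × S3 => N.pushAux y.1 y.2) (τ, x) := by
  by_cases h : x ∈ Set.range N.tube
  · have hev : (fun y : ℝ × S3 => N.tube ((N.coord y.2).1, radial y.1 (N.coord y.2).2)) =ᶠ[nhds (τ, x)]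
        fun y => N.pushAux y.1 y.2 := by
      have : Set.range N.tube ∈ nhds x := N.isOpenEmbedding_tube.isOpen_range.mem_nhds h
      filter_upwards [continuousAt_snd.preimage_mem_nhds this] with y hy
      obtain ⟨p, hp⟩ := hy
      rw [← hp, pushAux_tube, coord_tube]
    obtain ⟨p, rfl⟩ := h
    rw [tube_mem_range_curve] at hx
    refine ContinuousAt.congr ?_ hev
    refine N.isOpenEmbedding_tube.continuous.continuousAt.comp ?_
    have h1 : ContinuousAt (fun y : ℝ × S3 => N.coord y.2) (τ, N.tube p) :=
      ContinuousAt.comp (f := Prod.snd) (N.continuousAt_coord p) continuousAt_snd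
    have h2 : ContinuousAt (fun y : ℝ × S3 => (y.1, (N.coord y.2).2)) (τ, N.tube p) :=
      continuousAt_fst.prodMk h1.snd
    have h3 : ContinuousAt (fun p : ℝ × ℂ => radial p.1 p.2) (τ, (N.coord (N.tube p)).2) :=
      continuousAt_radial (by simpa using hx)
    have h4 : ContinuousAt (fun y : ℝ × S3 => radial y.1 (N.coord y.2).2) (τ, N.tube p) :=
      ContinuousAt.comp (g := fun p : ℝ × ℂ => radial p.1 p.2)
        (f := fun y : ℝ × S3 => (y.1, (N.coord y.2).2)) h3 h2
    exact h1.fst.prodMk h4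
  · have hmem : x ∈ (N.tube '' {p | ‖p.2‖ ≤ 1})ᶜ := by
      rintro ⟨p, -, rfl⟩
      exact h ⟨p, rfl⟩
    have hev : (fun y : ℝ × S3 => y.2) =ᶠ[nhds (τ, x)] fun y => N.pushAux y.1 y.2 := by
      filter_upwards [continuousAt_snd.preimage_mem_nhds
        (N.isClosed_closedTube.isOpen_compl.mem_nhds hmem)] with y hy
      exact (N.pushAux_eq_self _ fun h => hy (N.openTube_subset_closedTube h)).symm
    exact continuousAt_snd.congr hev

/-- The deformation of the knot complement onto the exterior. -/
noncomputable def push : C(I × K.Complement, K.Complement) where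
  toFun y := ⟨N.pushAux y.1 y.2, N.pushAux_notMem y.1.2 y.2.2⟩
  continuous_toFun := by
    refine Continuous.subtype_mk (continuous_iff_continuousAt.2 fun y => ?_) _
    exact ContinuousAt.comp (f := fun y : I × K.Complement => ((y.1 : ℝ), (y.2 : S3)))
      (N.continuousAt_pushAux y.1 y.2.2) (by fun_prop)

/-- The retraction of the knot complement onto the exterior. -/
noncomputable def retract : C(K.Complement, N.Exterior) where
  toFun x := ⟨N.push (1, x), N.pushAux_one_notMem x.2⟩
  continuous_toFun := by
    have h : Continuous fun x : K.Complement => N.push (1, x) :=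
      N.push.continuous.comp (by fun_prop)
    exact (continuous_subtype_val.comp h).subtype_mk _

@[simp] theorem retract_inclusion (x : N.Exterior) : N.retract (N.inclusion x) = x :=
  Subtype.ext (N.pushAux_eq_self 1 x.2)

theorem push_zero (x : K.Complement) : N.push (0, x) = x := Subtype.ext (N.pushAux_zero x)

theorem push_one (x : K.Complement) : N.push (1, x) = N.inclusion (N.retract x) := rfl

theorem push_inclusion (τ : I) (x : N.Exterior) : N.push (τ, N.inclusion x) = N.inclusion x :=
  Subtype.ext (N.pushAux_eq_self τ x.2)

/-! ### Connectedness -/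

/-- Follow a path in `S³` towards the knot and stop when it first meets the closed solid torus. -/
theorem exists_boundaryPath (x : N.Exterior) : Nonempty (N.BoundaryPath x) := by
  have hS3 : IsPathConnected (Metric.sphere (0 : EuclideanSpace ℝ (Fin 4)) 1) := by
    refine isPathConnected_sphere ?_ 0 zero_le_one
    rw [← Module.finrank_eq_rank, finrank_euclideanSpace_fin]
    norm_num
  have : PathConnectedSpace S3 := isPathConnected_iff_pathConnectedSpace.1 hS3
  let γ : Path x.1 (N.tube (1, 0)) := PathConnectedSpace.somePath _ _
  have hC : IsClosed (γ ⁻¹' (N.tube '' {p | ‖p.2‖ ≤ 1})) :=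
    N.isClosed_closedTube.preimage γ.continuous
  obtain ⟨s₀, ⟨⟨z, w⟩, hw, hzw⟩, hs₀⟩ := hC.isCompact.exists_isLeast ⟨1, (1, 0), by simp⟩
  have hout : ∀ s ≤ s₀, γ s ∉ N.tube '' {p | ‖p.2‖ < 1} := by
    intro s hs hmem
    have hs' : s = s₀ :=
      le_antisymm hs (hs₀ (N.openTube_subset_closedTube hmem))
    subst hs'
    by_cases h0 : s = 0
    · subst h0
      rw [γ.source] at hmem
      exact x.2 hmem
    -- At a positive first time the path cannot be in the open solid torus, or it would have been
    -- there slightly earlier.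
    · have h1 : γ ⁻¹' (N.tube '' {p | ‖p.2‖ < 1}) ∈ nhds s :=
        (N.isOpen_openTube.preimage γ.continuous).mem_nhds hmem
      obtain ⟨l, hl, hls⟩ := exists_Ioc_subset_of_mem_nhds h1 ⟨0, lt_of_le_of_ne s.2.1 (Ne.symm h0)⟩
      obtain ⟨m, hlm, hms⟩ := exists_between hl
      exact absurd (hs₀ (N.openTube_subset_closedTube (hls ⟨hlm, hms.le⟩))) (not_le.2 hms)
  have hw1 : ‖w‖ = 1 := le_antisymm hw (not_lt.1 fun h => hout s₀ le_rfl ⟨(z, w), h, hzw⟩)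
  let w' : Circle := ⟨w, mem_sphere_zero_iff_norm.2 hw1⟩
  exact ⟨(z, w'),
    { toFun := fun s => ⟨γ (s * s₀), hout _ (unitInterval.mul_le_right)⟩
      continuous_toFun := by fun_prop
      source' := Subtype.ext (by simp)
      target' := Subtype.ext (by simp [← hzw, boundary, w']) }⟩

theorem exists_path (x y : N.Exterior) : Nonempty (Path x y) := by
  obtain ⟨α⟩ := N.exists_boundaryPath x
  obtain ⟨β⟩ := N.exists_boundaryPath y
  let δ : Path α.endpoint β.endpoint := PathConnectedSpace.somePath _ _
  exact ⟨(α.path.trans (δ.map N.boundary.continuous)).trans β.path.symm⟩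

theorem exists_path_complement (x₀ : N.Exterior) (x : K.Complement) :
    Nonempty (Path (N.inclusion x₀) x) := by
  obtain ⟨p⟩ := N.exists_path x₀ (N.retract x)
  let q : Path x (N.inclusion (N.retract x)) :=
    { toFun := fun τ => N.push (τ, x)
      continuous_toFun := by fun_prop
      source' := N.push_zero x
      target' := N.push_one x }
  exact ⟨(p.map N.inclusion.continuous).trans q.symm⟩

/-! ### The knot group as a group of loops -/

variable {N}
variable {x₀ : N.Exterior}

/-- The class of a loop in the knot group. -/
noncomputable def loopClass (p : Path (N.inclusion x₀) (N.inclusion x₀)) : N.KnotGroup x₀ :=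
  MulOpposite.op (FundamentalGroup.fromPath (Path.Homotopic.Quotient.mk p))

theorem loopClass_surjective (γ : N.KnotGroup x₀) : ∃ p, loopClass p = γ := by
  obtain ⟨p, hp⟩ := Path.Homotopic.Quotient.mk_surjective (MulOpposite.unop γ)
  exact ⟨p, congrArg MulOpposite.op hp⟩

theorem loopClass_eq {p q : Path (N.inclusion x₀) (N.inclusion x₀)} (h : p.Homotopic q) :
    loopClass p = loopClass q :=
  congrArg MulOpposite.op (Path.Homotopic.Quotient.eq.2 h)

theorem loopClass_trans (p q : Path (N.inclusion x₀) (N.inclusion x₀)) :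
    loopClass (p.trans q) = loopClass p * loopClass q := rfl

theorem loopClass_refl : loopClass (Path.refl (N.inclusion x₀)) = 1 := rfl

theorem loopClass_symm (p : Path (N.inclusion x₀) (N.inclusion x₀)) :
    loopClass p.symm = (loopClass p)⁻¹ := by
  rw [eq_inv_iff_mul_eq_one, ← loopClass_trans, ← loopClass_refl]
  exact loopClass_eq (Path.Homotopic.symm_trans p)

/-- The class of a boundary path in the knot quandle. -/
def BoundaryPath.toQuandle (α : N.BoundaryPath x₀) : N.KnotQuandle x₀ :=
  Quotient.mk (N.boundaryPathSetoid x₀) α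

theorem BoundaryPath.toQuandle_surjective (q : N.KnotQuandle x₀) :
    ∃ α : N.BoundaryPath x₀, α.toQuandle = q := Quotient.exists_rep q

theorem meridian_toQuandle (α : N.BoundaryPath x₀) :
    meridian α.toQuandle =
      loopClass (α.loop.map N.inclusion.continuous) := rfl

/-- The homomorphism from the knot group given by a functor on the fundamental groupoid. -/
noncomputable def homOfHolonomy {G : Type*} [Group G] (H : PathHolonomy K.Complement G) :
    N.KnotGroup x₀ →* G :=
  MonoidHom.mk' (fun γ => Quotient.lift H.val (fun _ _ h => H.val_eq_of_homotopic h)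
    (MulOpposite.unop γ)) fun γ γ' => by
      obtain ⟨p, rfl⟩ := loopClass_surjective γ
      obtain ⟨q, rfl⟩ := loopClass_surjective γ'
      exact H.val_trans p q

theorem homOfHolonomy_loopClass {G : Type*} [Group G] (H : PathHolonomy K.Complement G)
    (p : Path (N.inclusion x₀) (N.inclusion x₀)) : homOfHolonomy H (loopClass p) = H.val p := rfl

/-- A homomorphism from the knot group, extended to the fundamental groupoid. -/
noncomputable def holonomyOfHom {G : Type*} [Group G] (φ : N.KnotGroup x₀ →* G)
    (P : ∀ x, Path (N.inclusion x₀) x) : PathHolonomy K.Complement G where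
  val {x y} p := φ (loopClass ((P x).trans (p.trans (P y).symm)))
  val_trans {x y z} p q := by
    rw [← map_mul, ← loopClass_trans]
    refine congrArg φ (loopClass_eq (Path.Homotopic.Quotient.eq.1 ?_))
    simp only [Path.Homotopic.Quotient.mk_trans, Path.Homotopic.Quotient.mk_symm,
      Path.Homotopic.Quotient.trans_assoc]
    rw [← Path.Homotopic.Quotient.trans_assoc (Path.Homotopic.Quotient.symm _)]
    simp
  val_eq_of_homotopic h :=
    congrArg φ (loopClass_eq ((Path.Homotopic.refl _).hcomp (h.hcomp (Path.Homotopic.refl _))))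

/-! ### The action of the knot group on the knot quandle -/

/-- The image of a loop in the knot complement under the retraction to the exterior. -/
noncomputable def retractLoop (p : Path (N.inclusion x₀) (N.inclusion x₀)) : Path x₀ x₀ :=
  (p.map N.retract.continuous).cast (N.retract_inclusion x₀).symm (N.retract_inclusion x₀).symm

theorem retractLoop_homotopic {p q : Path (N.inclusion x₀) (N.inclusion x₀)} (h : p.Homotopic q) :
    (retractLoop p).Homotopic (retractLoop q) :=
  (h.map N.retract).pathCast _ _

theorem retractLoop_trans (p q : Path (N.inclusion x₀) (N.inclusion x₀)) :
    retractLoop (p.trans q) = (retractLoop p).trans (retractLoop q) := by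
  simp only [retractLoop, Path.map_trans]
  rfl

theorem retractLoop_map (p : Path x₀ x₀) : retractLoop (p.map N.inclusion.continuous) = p :=
  Path.ext (funext fun _ => N.retract_inclusion _)

/-- The deformation `push` fixes the exterior, hence the base point. -/
theorem map_retractLoop_homotopic (p : Path (N.inclusion x₀) (N.inclusion x₀)) :
    ((retractLoop p).map N.inclusion.continuous).Homotopic p := by
  refine Path.Homotopic.symm
    ⟨{  toFun := fun y => N.push (y.1, p y.2)
        continuous_toFun := by fun_prop
        map_zero_left := fun s => N.push_zero _
        map_one_left := fun s => N.push_one _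
        prop' := ?_ }⟩
  rintro τ s (rfl | rfl)
  · simp [push_inclusion]
  · simp [push_inclusion]

/-- A boundary path preceded by a loop. -/
noncomputable def BoundaryPath.prepend (l : Path x₀ x₀) (α : N.BoundaryPath x₀) : N.BoundaryPath x₀ :=
  ⟨α.endpoint, l.trans α.path⟩

theorem BoundaryPath.prepend_homotopic {α β : N.BoundaryPath x₀} {l l' : Path x₀ x₀}
    (hl : l.Homotopic l') (h : α.Homotopic β) : (α.prepend l).Homotopic (β.prepend l') :=
  BoundaryPath.homotopic_trans hl h

theorem BoundaryPath.loop_prepend (l : Path x₀ x₀) (α : N.BoundaryPath x₀) :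
    (α.prepend l).loop.Homotopic (l.trans (α.loop.trans l.symm)) := by
  refine Path.Homotopic.Quotient.eq.1 ?_
  simp [BoundaryPath.loop, BoundaryPath.prepend, Path.trans_symm]

/-- Boundary paths live in the exterior and loops in the complement, so a loop is retracted before
being prepended. -/
noncomputable instance : MulAction (N.KnotGroup x₀) (N.KnotQuandle x₀) where
  smul γ q := Quotient.map₂ (fun p α => BoundaryPath.prepend (retractLoop p) α)
    (fun _ _ h _ _ h' => BoundaryPath.prepend_homotopic (retractLoop_homotopic h) h')
    (MulOpposite.unop γ) q
  one_smul := by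
    rintro ⟨α⟩
    refine Quotient.sound (BoundaryPath.homotopic_of_eq ?_)
    have h : retractLoop (Path.refl (N.inclusion x₀)) = Path.refl x₀ := retractLoop_map (Path.refl x₀)
    exact (congrArg (fun l : Path x₀ x₀ => (l.trans α.path).Homotopic α.path) h).mpr
      (Path.Homotopic.refl_trans α.path)
  mul_smul := by
    intro γ γ'
    obtain ⟨p, rfl⟩ := loopClass_surjective γ
    obtain ⟨q, rfl⟩ := loopClass_surjective γ'
    rintro ⟨α⟩
    refine Quotient.sound (BoundaryPath.homotopic_of_eq ?_)
    rw [retractLoop_trans]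
    exact Path.Homotopic.trans_assoc _ _ _

theorem loopClass_smul_toQuandle (p : Path (N.inclusion x₀) (N.inclusion x₀)) (α : N.BoundaryPath x₀) :
    loopClass p • α.toQuandle = (α.prepend (retractLoop p)).toQuandle := rfl

theorem meridian_smul (α β : N.KnotQuandle x₀) :
    (meridian α : N.KnotGroup x₀) • β = α ◃ β := by
  obtain ⟨α, rfl⟩ := BoundaryPath.toQuandle_surjective α
  obtain ⟨β, rfl⟩ := BoundaryPath.toQuandle_surjective β
  rw [meridian_toQuandle, loopClass_smul_toQuandle, retractLoop_map]
  rfl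

/-- The prepended loop appears at both ends of the meridian loop. This equivariance makes the
subgroup generated by meridians normal. -/
theorem meridian_smul_eq_conj (γ : N.KnotGroup x₀) (α : N.KnotQuandle x₀) :
    meridian (γ • α) = γ * (meridian α : N.KnotGroup x₀) * γ⁻¹ := by
  obtain ⟨α, rfl⟩ := BoundaryPath.toQuandle_surjective α
  obtain ⟨p, rfl⟩ := loopClass_surjective γ
  rw [loopClass_smul_toQuandle, meridian_toQuandle, meridian_toQuandle, ← loopClass_symm, mul_assoc, ← loopClass_trans,
    ← loopClass_trans]
  refine loopClass_eq (((BoundaryPath.loop_prepend _ _).map N.inclusion).trans ?_)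
  have h := map_retractLoop_homotopic p
  rw [Path.map_trans, Path.map_trans]
  exact h.hcomp ((Path.Homotopic.refl _).hcomp h.symm₂)

instance : MulAction.IsPretransitive (N.KnotGroup x₀) (N.KnotQuandle x₀) where
  exists_smul_eq α β := by
    obtain ⟨α, rfl⟩ := BoundaryPath.toQuandle_surjective α
    obtain ⟨β, rfl⟩ := BoundaryPath.toQuandle_surjective β
    let δ : Path α.endpoint β.endpoint := PathConnectedSpace.somePath _ _
    -- Out along `β`, across the connected boundary torus, and back along `α`.
    let l : Path x₀ x₀ := β.path.trans (α.path.trans (δ.map N.boundary.continuous)).symm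
    refine ⟨loopClass (l.map N.inclusion.continuous), ?_⟩
    rw [loopClass_smul_toQuandle, retractLoop_map]
    refine Quotient.sound (BoundaryPath.homotopic_of_path δ (Path.Homotopic.Quotient.eq.1 ?_))
    simp only [BoundaryPath.prepend, l]
    generalize δ.map N.boundary.continuous = d
    simp [Path.trans_symm]

instance : Nonempty (N.KnotQuandle x₀) :=
  (N.exists_boundaryPath x₀).map BoundaryPath.toQuandle

end TubularNeighbourhood

/-! ### The linking number -/

/-- The radial projection `ℂ^* → S¹`. -/
noncomputable def Circle.ofNeZero (w : ℂ) : Circle :=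
  if h : w ≠ 0 then
    ⟨w / ‖w‖, mem_sphere_zero_iff_norm.2 (by
      rw [norm_div, Complex.norm_real, norm_norm, div_self (norm_ne_zero_iff.2 h)])⟩
  else 1

theorem Circle.coe_ofNeZero {w : ℂ} (hw : w ≠ 0) : (Circle.ofNeZero w : ℂ) = w / ‖w‖ :=
  congrArg (fun z : Circle => (z : ℂ)) (dif_pos hw)

theorem Circle.ofNeZero_coe (w : Circle) : Circle.ofNeZero w = w :=
  Circle.ext (by rw [Circle.coe_ofNeZero w.coe_ne_zero, w.norm_coe]; simp)

theorem Circle.continuousOn_ofNeZero : ContinuousOn Circle.ofNeZero {0}ᶜ := by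
  have hind : @Topology.IsInducing Circle ℂ _ _ (fun z => (z : ℂ)) := ⟨rfl⟩
  refine hind.continuousOn_iff.2 ?_
  have h : ContinuousOn (fun w : ℂ => w / ‖w‖) {0}ᶜ :=
    continuousOn_id.div (by fun_prop) fun w hw => by simpa using hw
  exact h.congr fun w hw => Circle.coe_ofNeZero hw

namespace TubularNeighbourhood

variable {K : Knot} (N : TubularNeighbourhood K)

theorem mem_range_tube_of_mem_range_curve {x : S3} (hx : x ∈ Set.range K.curve) :
    x ∈ Set.range N.tube := by
  obtain ⟨z, rfl⟩ := hx
  exact ⟨(z, 0), N.tube_core z⟩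

theorem isOpen_compl_range_curve : IsOpen (Set.range K.curve)ᶜ :=
  (isCompact_range K.curve.continuous).isClosed.isOpen_compl

theorem continuousOn_coord : ContinuousOn N.coord (Set.range N.tube) := by
  rintro _ ⟨p, rfl⟩
  exact (N.continuousAt_coord p).continuousWithinAt

theorem coord_snd_ne_zero {x : S3} (hx : x ∈ Set.range N.tube) (hx' : x ∉ Set.range K.curve) :
    (N.coord x).2 ≠ 0 := by
  obtain ⟨p, rfl⟩ := hx
  rw [tube_mem_range_curve] at hx'
  simpa using hx'

/-- A map from the knot complement to the circle that winds once around each of the meridians over a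
point of the knot. -/
theorem exists_circle_map : ∃ (u : C(K.Complement, Circle)) (z : Circle) (V : C(ℂ, Circle)),
    ∀ (w : Circle), u (N.tubeCompl (z, w) w.coe_ne_zero) = w * V w := by
  obtain ⟨q, sec, hsec, hq⟩ := S3.exists_cube_parametrization (N.tube (1, 0))
  let g : S3 → Circle := fun x => Circle.ofNeZero (N.coord x).2
  have hg : ContinuousOn g ((Set.range K.curve)ᶜ ∩ Set.range N.tube) :=
    Circle.continuousOn_ofNeZero.comp
      (continuous_snd.comp_continuousOn (N.continuousOn_coord.mono Set.inter_subset_right))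
      fun x hx => N.coord_snd_ne_zero hx.2 hx.1
  -- The charts are the complement (`true`) and the tube (`false`), with transition function `w /
  -- ‖w‖` on the punctured tube. The section is continuous itself over the first and after division
  -- by `g` over the second.
  let B : Bool → Set (Fin 3 → ℝ) := fun b =>
    bif b then q ⁻¹' (Set.range K.curve)ᶜ else q ⁻¹' Set.range N.tube
  let c : Bool → (Fin 3 → ℝ) → Circle := fun b x => bif b then 1 else g (q x)
  have hgq : ContinuousOn (fun x => g (q x)) (B true ∩ B false) :=
    hg.comp q.continuous.continuousOn fun x hx => hx
  obtain ⟨s, hs⟩ := exists_isTorsorSection_Icc (B := B) (c := c)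
    (by
      rintro (_ | _)
      · exact N.isOpenEmbedding_tube.isOpen_range.preimage q.continuous
      · exact isOpen_compl_range_curve.preimage q.continuous)
    (by
      rintro (_ | _) (_ | _)
      · simp only [mul_inv_cancel]
        exact continuousOn_const
      · simpa [c, Set.inter_comm] using hgq
      · exact hgq.inv.congr fun x _ => one_mul _
      · simp only [mul_inv_cancel]
        exact continuousOn_const)
    (-1) 1 (fun x _ => by
      by_cases h : q x ∈ Set.range K.curve
      · exact Set.mem_iUnion.2 ⟨false, N.mem_range_tube_of_mem_range_curve h⟩
      · exact Set.mem_iUnion.2 ⟨true, h⟩)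
  have hne : ∀ x : K.Complement, (x : S3) ≠ N.tube (1, 0) := fun x hx =>
    x.2 (hx ▸ N.tube_mem_range_curve.2 rfl)
  have hne' : ∀ w : ℂ, N.tube (-1, w) ≠ N.tube (1, 0) := fun w hw => by
    have h1 := congrArg (fun p : Circle × ℂ => (p.1 : ℂ)) (N.isOpenEmbedding_tube.injective hw)
    norm_num at h1
  have hu : Continuous fun x : K.Complement => s (sec x) := by
    have h1 : ContinuousOn s (B true ∩ Set.Icc (-1) 1) := by simpa [c] using hs true
    refine h1.comp_continuous (hsec.comp_continuous continuous_subtype_val hne) fun x =>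
      ⟨?_, (hq x (hne x)).1⟩
    change q (sec x) ∉ _
    rw [(hq x (hne x)).2]
    exact x.2
  have hV : Continuous fun w : ℂ => s (sec (N.tube (-1, w))) * (g (q (sec (N.tube (-1, w)))))⁻¹ := by
    have h2 := N.isOpenEmbedding_tube.continuous
    refine (hs false).comp_continuous (hsec.comp_continuous (by fun_prop) hne') fun w =>
      ⟨?_, (hq _ (hne' w)).1⟩
    change q (sec (N.tube (-1, w))) ∈ Set.range N.tube
    rw [(hq _ (hne' w)).2]
    exact ⟨_, rfl⟩
  -- The fibre of the tube over `-1` avoids the puncture over `1`, so `V` is continuous on all of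
  -- it, centre included.
  refine ⟨⟨_, hu⟩, -1, ⟨_, hV⟩, fun w => ?_⟩
  simp only [ContinuousMap.coe_mk, tubeCompl]
  rw [(hq _ (hne' w)).2]
  simp only [g, coord_tube, Circle.ofNeZero_coe]
  rw [mul_comm, inv_mul_cancel_right]

variable {N} {x₀ : N.Exterior}

theorem exists_boundaryPath_endpoint (p : Circle × Circle) :
    ∃ α : N.BoundaryPath x₀, α.endpoint = p :=
  ⟨⟨p, (N.exists_path x₀ (N.boundary p)).some⟩, rfl⟩

theorem holonomy_val_loop {G : Type*} [Group G] (H : PathHolonomy K.Complement G)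
    (α : N.BoundaryPath x₀) : H.val (α.loop.map N.inclusion.continuous) =
      H.val (α.path.map N.inclusion.continuous) *
        H.val ((N.meridianLoop α.endpoint).map N.inclusion.continuous) *
        (H.val (α.path.map N.inclusion.continuous))⁻¹ := by
  simp only [BoundaryPath.loop, Path.map_trans, H.val_trans]
  rw [mul_assoc, ← H.val_symm, Path.map_symm]

/-- The linking number with the knot. -/
theorem exists_linking_character : ∃ lk : N.KnotGroup x₀ →* Multiplicative ℂ,
    ∀ α : N.KnotQuandle x₀, lk (meridian α) = Multiplicative.ofAdd 1 := by
  obtain ⟨u, z, V, hu⟩ := N.exists_circle_map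
  obtain ⟨θ, hθ⟩ := Circle.exp_surjective (V 0)
  -- As `V` is defined on the whole plane it has a real logarithm, so it adds nothing to the winding
  -- number.
  obtain ⟨L, ⟨-, hL⟩, -⟩ := Circle.isCoveringMap_exp.existsUnique_continuousMap_lifts V 0 θ hθ
  let lkR : N.KnotGroup x₀ →* Multiplicative ℝ := homOfHolonomy (Circle.windingHolonomy.comap u)
  let scale : Multiplicative ℝ →* Multiplicative ℂ := AddMonoidHom.toMultiplicative
    ((AddMonoidHom.mulRight ((2 * Real.pi : ℂ)⁻¹)).comp Complex.ofRealHom.toAddMonoidHom)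
  refine ⟨scale.comp lkR, ?_⟩
  obtain ⟨α, hα⟩ := exists_boundaryPath_endpoint (x₀ := x₀) (z, 1)
  have key : lkR (meridian α.toQuandle) = Multiplicative.ofAdd (2 * Real.pi) := by
    rw [meridian_toQuandle, homOfHolonomy_loopClass, holonomy_val_loop, mul_inv_cancel_comm,
      hα]
    refine congrArg Multiplicative.ofAdd ((Circle.sweptAngle_eq
      (⟨fun s => 2 * Real.pi * s + L (Circle.exp (2 * Real.pi * s)), by fun_prop⟩ : C(I, ℝ))
      fun s => ?_).trans ?_)
    · have h1 := hu (Circle.exp (2 * Real.pi * s))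
      have h2 := congrFun hL (Circle.exp (2 * Real.pi * s) : ℂ)
      simp only [Function.comp_apply] at h2
      simp only [ContinuousMap.coe_mk, Circle.exp_add, h2]
      rw [← h1]
      refine congrArg u (Subtype.ext ?_)
      change N.tube (z, _) = N.tube (z, ((1 * Circle.exp (2 * Real.pi * s) : Circle) : ℂ))
      rw [one_mul]
    · simp
  -- By transitivity and equivariance all meridians are conjugate to the one just computed.
  intro β
  obtain ⟨γ, rfl⟩ := MulAction.exists_smul_eq (N.KnotGroup x₀) α.toQuandle β
  rw [meridian_smul_eq_conj, map_mul, map_mul, map_inv, mul_inv_cancel_comm]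
  simp only [MonoidHom.comp_apply, key]
  have hpi : (Real.pi : ℂ) ≠ 0 := Complex.ofReal_ne_zero.2 Real.pi_ne_zero
  refine congrArg Multiplicative.ofAdd (show ((2 * Real.pi : ℝ) : ℂ) * (2 * Real.pi : ℂ)⁻¹ = 1 from ?_)
  push_cast
  exact mul_inv_cancel₀ (mul_ne_zero two_ne_zero hpi)

end TubularNeighbourhood

/-! ### Potentials on convex sets -/

theorem PathHolonomy.exists_potential_on {E : Type*} [NormedAddCommGroup E] [NormedSpace ℝ E]
    {Y G : Type*} [TopologicalSpace Y] [Group G] (H : PathHolonomy Y G) {B : Set E}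
    (hB : Convex ℝ B) (hne : B.Nonempty) (f : C(B, Y)) :
    ∃ c : E → G, ∀ {a b : E} (ρ : Path a b) (hρ : ∀ s, ρ s ∈ B) {x y : Y} (r : Path x y),
      (∀ s, r s = f ⟨ρ s, hρ s⟩) → H.val r = (c a)⁻¹ * c b := by
  classical
  have : ContractibleSpace B := hB.contractibleSpace hne
  obtain ⟨c, hc⟩ := (H.comap f).exists_potential
  -- The value `1` outside `B` is a default; paths are required to stay in `B`.
  refine ⟨fun x => if h : x ∈ B then c ⟨x, h⟩ else 1, fun {a b} ρ hρ {x y} r hr => ?_⟩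
  have ha : a ∈ B := by simpa using hρ 0
  have hb : b ∈ B := by simpa using hρ 1
  let ρ' : Path (⟨a, ha⟩ : B) ⟨b, hb⟩ :=
    { toFun := fun s => ⟨ρ s, hρ s⟩
      continuous_toFun := by fun_prop
      source' := by simp
      target' := by simp }
  have h := hc ρ'
  rw [comap_val] at h
  simp only [dif_pos ha, dif_pos hb]
  rw [← h]
  exact H.val_congr _ _ hr

namespace TubularNeighbourhood

variable {K : Knot} (N : TubularNeighbourhood K)

/-! ### Cylindrical coordinates on the punctured tube -/

/-- The covering of the punctured tube by `S¹ × ℂ`. -/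
noncomputable def cyl : C(Circle × ℂ, K.Complement) where
  toFun p := N.tubeCompl (p.1, Complex.exp p.2) (Complex.exp_ne_zero _)
  continuous_toFun := by
    have h := N.isOpenEmbedding_tube.continuous
    exact Continuous.subtype_mk (by fun_prop) _

/-- The radial contraction of `S¹ × ℂ`, from the projection to the zero section to the identity. -/
noncomputable def radialHomotopy : ContinuousMap.Homotopy
    (⟨fun p => (p.1, 0), by fun_prop⟩ : C(Circle × ℂ, Circle × ℂ))
    (ContinuousMap.id (Circle × ℂ)) where
  toFun y := (y.2.1, ((y.1 : ℝ) : ℂ) * y.2.2)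
  continuous_toFun := by fun_prop
  map_zero_left p := by simp
  map_one_left p := by simp

variable {G : Type*} [Group G] (H : PathHolonomy K.Complement G)

/-- The value of a path functional on the radial path from `(z, 0)` to `(z, a)`. -/
noncomputable def radialVal (z : Circle) (a : ℂ) : G :=
  (H.comap N.cyl).val (radialHomotopy.evalAt (z, a))

/-- The path functional along the longitude. -/
noncomputable def longitudeHolonomy : PathHolonomy Circle G :=
  (H.comap N.cyl).comap ⟨fun z => (z, 0), by fun_prop⟩

/-- Contracting the factor `ℂ` slides a path to its projection on the longitude; the naturality
square supplies the two radial factors. -/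
theorem val_cyl {x y : Circle × ℂ} (p : Path x y) (ζ : Path x.1 y.1) (hζ : ∀ s, ζ s = (p s).1) :
    (H.comap N.cyl).val p =
      (N.radialVal H x.1 x.2)⁻¹ * (N.longitudeHolonomy H).val ζ * N.radialVal H y.1 y.2 := by
  have h := (H.comap N.cyl).val_eq_of_homotopic (Path.Homotopic.map_trans_evalAt radialHomotopy p)
  rw [PathHolonomy.val_trans, PathHolonomy.val_trans] at h
  have h1 : (H.comap N.cyl).val p = (H.comap N.cyl).val (p.map (ContinuousMap.id _).continuous) :=
    PathHolonomy.val_congr _ _ _ fun _ => rfl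
  have h2 : (N.longitudeHolonomy H).val ζ = (H.comap N.cyl).val (p.map
      (⟨fun p => (p.1, 0), by fun_prop⟩ : C(Circle × ℂ, Circle × ℂ)).continuous) :=
    (H.comap N.cyl).val_congr _ _ fun s => Prod.ext (hζ s) rfl
  rw [h1, h2, mul_assoc, eq_inv_mul_iff_mul_eq]
  exact h.symm

/-- A path functional that is trivial on the meridians. -/
def KillsMeridians : Prop :=
  ∀ p, H.val ((N.meridianLoop p).map N.inclusion.continuous) = 1

variable {N H}

/-- Going to `a + 2πi` by way of `2πi` covers a meridian, which is killed, followed by the image of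
the radial path to `a`. -/
theorem KillsMeridians.periodic (h : N.KillsMeridians H) (z : Circle) :
    Function.Periodic (N.radialVal H z) (2 * Real.pi * Complex.I) := by
  intro a
  let p : Path (z, 2 * Real.pi * Complex.I) (z, a + 2 * Real.pi * Complex.I) :=
    { toFun := fun s => (z, (s : ℝ) * a + 2 * Real.pi * Complex.I)
      continuous_toFun := by fun_prop
      source' := by simp
      target' := by simp }
  have h1 := N.val_cyl H p (Path.refl z) fun _ => rfl
  have h2 : (H.comap N.cyl).val p = N.radialVal H z a :=
    H.val_congr _ _ fun s => Subtype.ext <| by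
      change N.tube (z, Complex.exp ((s : ℝ) * a + 2 * Real.pi * Complex.I)) =
        N.tube (z, Complex.exp ((s : ℝ) * a))
      rw [Complex.exp_add, Complex.exp_two_pi_mul_I, mul_one]
  have h3 : N.radialVal H z (2 * Real.pi * Complex.I) = 1 := by
    rw [← h (z, 1)]
    refine H.val_congr _ _ fun s => Subtype.ext ?_
    change N.tube (z, Complex.exp ((s : ℝ) * (2 * Real.pi * Complex.I))) =
      N.tube (z, ((1 * Circle.exp (2 * Real.pi * s) : Circle) : ℂ))
    rw [one_mul, Circle.coe_exp]
    congr 3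
    push_cast
    ring
  rw [h2, PathHolonomy.val_refl, h3] at h1
  simpa using h1.symm

theorem KillsMeridians.radialVal_eq (h : N.KillsMeridians H) (z : Circle) {a b : ℂ}
    (hab : Complex.exp a = Complex.exp b) : N.radialVal H z a = N.radialVal H z b := by
  obtain ⟨n, rfl⟩ := Complex.exp_eq_exp_iff_exists_int.1 hab
  exact (h.periodic z).int_mul n b

variable (N H) in
/-- The value of a path functional on the radial path to a point of the punctured tube. -/
noncomputable def tubeGauge (x : S3) : G :=
  -- Periodicity makes the branch of the logarithm irrelevant on the punctured tube. On the knot,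
  -- `log 0 = 0` gives a harmless default.
  N.radialVal H (N.coord x).1 (Complex.log (N.coord x).2)

/-- Lift the path through `exp`. Up to the gauge only the circle coordinate remains, and that
coordinate extends across the knot. -/
theorem KillsMeridians.val_eq_of_mem_tube (h : N.KillsMeridians H) {x y : K.Complement}
    (r : Path x y) (hr : ∀ s, (r s : S3) ∈ Set.range N.tube) {z z' : Circle} (ζ : Path z z')
    (hζ : ∀ s, ζ s = (N.coord (r s)).1) :
    H.val r = (N.tubeGauge H x)⁻¹ * (N.longitudeHolonomy H).val ζ * N.tubeGauge H y := by
  have hc : Continuous fun s => N.coord (r s) :=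
    N.continuousOn_coord.comp_continuous (by fun_prop) hr
  have hw : ∀ s, (N.coord (r s)).2 ≠ 0 := fun s => N.coord_snd_ne_zero (hr s) (r s).2
  have : ContractibleSpace I := (convex_Icc (0 : ℝ) 1).contractibleSpace ⟨0, by simp⟩
  obtain ⟨l, hl, hl0⟩ := Complex.isCoveringMap_exp.exists_path_lifts
    (⟨fun s => ⟨(N.coord (r s)).2, hw s⟩, by fun_prop⟩ : C(I, {w : ℂ // w ≠ 0}))
    (Complex.log (N.coord (r 0)).2) (Subtype.ext (Complex.exp_log (hw 0)).symm)
  have hexp : ∀ s, Complex.exp (l s) = (N.coord (r s)).2 := fun s =>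
    congrArg Subtype.val (congrFun hl s)
  let p : Path (z, l 0) (z', l 1) :=
    { toFun := fun s => (ζ s, l s)
      continuous_toFun := by fun_prop
      source' := by simp
      target' := by simp }
  have key := N.val_cyl H p ζ fun _ => rfl
  have h1 : H.val r = (H.comap N.cyl).val p := H.val_congr _ _ fun s => Subtype.ext <| by
    obtain ⟨P, hP⟩ := hr s
    change (r s : S3) = N.tube (ζ s, Complex.exp (l s))
    rw [hexp, hζ, ← hP, coord_tube]
  have h2 : ∀ s, N.radialVal H (ζ s) (l s) = N.tubeGauge H (r s) := fun s => by
    rw [tubeGauge, hζ]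
    exact h.radialVal_eq _ (by rw [hexp, Complex.exp_log (hw s)])
  have e0 := h2 0
  have e1 := h2 1
  simp only [Path.source, Path.target] at e0 e1
  rw [h1, key, e0, e1]

/-! ### Path functionals that are trivial on meridians are trivial on loops -/

section Section

variable {E : Type*} [NormedAddCommGroup E] [NormedSpace ℝ E]

variable (N H) in
/-- A local section, over a convex open set, of the torsor given by a path functional. -/
structure LocalSection (q : C(E, S3)) where
  base : Set E
  toFun : E → G
  isOpen : IsOpen base
  convex : Convex ℝ base
  -- Off the knot the section is a potential of `H`; in the tube it is one for the gauged longitude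
  -- functional, which also makes sense on the knot.
  spec : ((∀ x ∈ base, q x ∉ Set.range K.curve) ∧
      ∀ {a b : E} (ρ : Path a b) (_ : ∀ s, ρ s ∈ base) {x y : K.Complement} (r : Path x y),
        (∀ s, (r s : S3) = q (ρ s)) → H.val r = (toFun a)⁻¹ * toFun b) ∨
    ((∀ x ∈ base, q x ∈ Set.range N.tube) ∧
      ∀ {a b : E} (ρ : Path a b) (_ : ∀ s, ρ s ∈ base) {z z' : Circle} (ζ : Path z z'),
        (∀ s, ζ s = (N.coord (q (ρ s))).1) →
        (N.tubeGauge H (q a))⁻¹ * (N.longitudeHolonomy H).val ζ * N.tubeGauge H (q b) =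
          (toFun a)⁻¹ * toFun b)

theorem exists_localSection_compl (q : C(E, S3)) (x : E) (hx : q x ∉ Set.range K.curve) :
    ∃ i : LocalSection N H q, x ∈ i.base ∧ (∀ y ∈ i.base, q y ∉ Set.range K.curve) ∧
      ∀ {a b : E} (ρ : Path a b) (_ : ∀ s, ρ s ∈ i.base) {x y : K.Complement} (r : Path x y),
        (∀ s, (r s : S3) = q (ρ s)) → H.val r = (i.toFun a)⁻¹ * i.toFun b := by
  obtain ⟨ε, hε, hB⟩ := Metric.isOpen_iff.1
    (isOpen_compl_range_curve.preimage q.continuous : IsOpen (q ⁻¹' (Set.range K.curve)ᶜ)) x hx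
  obtain ⟨c, hc⟩ := H.exists_potential_on (convex_ball x ε) ⟨x, Metric.mem_ball_self hε⟩
    ⟨fun y => ⟨q y, hB y.2⟩, by fun_prop⟩
  have h : ∀ {a b : E} (ρ : Path a b) (_ : ∀ s, ρ s ∈ Metric.ball x ε) {x y : K.Complement}
      (r : Path x y), (∀ s, (r s : S3) = q (ρ s)) → H.val r = (c a)⁻¹ * c b :=
    fun ρ hρ _ _ r hr => hc ρ hρ r fun s => Subtype.ext (hr s)
  exact ⟨⟨Metric.ball x ε, c, Metric.isOpen_ball, convex_ball x ε, .inl ⟨fun y hy => hB hy, h⟩⟩,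
    Metric.mem_ball_self hε, fun y hy => hB hy, h⟩

theorem exists_localSection_tube (q : C(E, S3)) (x : E) (hx : q x ∈ Set.range N.tube) :
    ∃ i : LocalSection N H q, x ∈ i.base := by
  obtain ⟨ε, hε, hB⟩ := Metric.isOpen_iff.1
    (N.isOpenEmbedding_tube.isOpen_range.preimage q.continuous) x hx
  have hc1 : Continuous fun y : Metric.ball x ε => N.coord (q y) :=
    N.continuousOn_coord.comp_continuous (by fun_prop) fun y => hB y.2
  obtain ⟨c, hc⟩ := (N.longitudeHolonomy H).exists_potential_on (convex_ball x ε)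
    ⟨x, Metric.mem_ball_self hε⟩ ⟨fun y => (N.coord (q y)).1, by fun_prop⟩
  refine ⟨⟨Metric.ball x ε, fun y => c y * N.tubeGauge H (q y), Metric.isOpen_ball,
    convex_ball x ε, .inr ⟨fun y hy => hB hy, fun ρ hρ _ _ ζ hζ => ?_⟩⟩, Metric.mem_ball_self hε⟩
  rw [hc ρ hρ ζ hζ]
  group

/-- Along a segment in the convex overlap both sections have the same increment; for sections of
different kinds this is `val_eq_of_mem_tube`. -/
theorem LocalSection.toFun_mul_inv_eq (h : N.KillsMeridians H) {q : C(E, S3)}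
    (i j : LocalSection N H q) {a b : E} (ha : a ∈ i.base ∩ j.base) (hb : b ∈ i.base ∩ j.base) :
    i.toFun a * (j.toFun a)⁻¹ = i.toFun b * (j.toFun b)⁻¹ := by
  let ρ : Path a b :=
    { toFun := fun s => AffineMap.lineMap a b (s : ℝ)
      continuous_toFun := by fun_prop
      source' := by simp
      target' := by simp }
  have hρ : ∀ s, ρ s ∈ i.base ∩ j.base := fun s =>
    (i.convex.inter j.convex).lineMap_mem ha hb s.2
  have compl_path : (∀ s, q (ρ s) ∉ Set.range K.curve) →
      ∃ (x y : K.Complement) (r : Path x y), ∀ s, (r s : S3) = q (ρ s) := fun hq =>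
    ⟨_, _, ⟨⟨fun s => ⟨q (ρ s), hq s⟩, by fun_prop⟩, rfl, rfl⟩, fun _ => rfl⟩
  have tube_path : (∀ s, q (ρ s) ∈ Set.range N.tube) →
      ∃ (z z' : Circle) (ζ : Path z z'), ∀ s, ζ s = (N.coord (q (ρ s))).1 := fun hq => by
    have hc : Continuous fun s => N.coord (q (ρ s)) :=
      N.continuousOn_coord.comp_continuous (by fun_prop) hq
    exact ⟨_, _, ⟨⟨fun s => (N.coord (q (ρ s))).1, by fun_prop⟩, rfl, rfl⟩, fun _ => rfl⟩
  have mixed : ∀ (x y : K.Complement) (r : Path x y), (∀ s, (r s : S3) = q (ρ s)) →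
      ∀ (z z' : Circle) (ζ : Path z z'), (∀ s, ζ s = (N.coord (q (ρ s))).1) →
      (∀ s, q (ρ s) ∈ Set.range N.tube) → H.val r =
        (N.tubeGauge H (q a))⁻¹ * (N.longitudeHolonomy H).val ζ * N.tubeGauge H (q b) := by
    intro x y r hr z z' ζ hζ hq
    have hx := hr 0
    have hy := hr 1
    simp only [Path.source, Path.target] at hx hy
    rw [← hx, ← hy]
    exact h.val_eq_of_mem_tube r (fun s => hr s ▸ hq s) ζ fun s => by rw [hζ, hr]
  suffices H1 : (i.toFun a)⁻¹ * i.toFun b = (j.toFun a)⁻¹ * j.toFun b by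
    rw [inv_mul_eq_iff_eq_mul] at H1
    rw [H1]
    group
  rcases i.spec with ⟨hi, hi'⟩ | ⟨hi, hi'⟩ <;> rcases j.spec with ⟨hj, hj'⟩ | ⟨hj, hj'⟩
  · obtain ⟨x, y, r, hr⟩ := compl_path fun s => hi _ (hρ s).1
    rw [← hi' ρ (fun s => (hρ s).1) r hr, ← hj' ρ (fun s => (hρ s).2) r hr]
  · obtain ⟨x, y, r, hr⟩ := compl_path fun s => hi _ (hρ s).1
    obtain ⟨z, z', ζ, hζ⟩ := tube_path fun s => hj _ (hρ s).2
    rw [← hi' ρ (fun s => (hρ s).1) r hr, ← hj' ρ (fun s => (hρ s).2) ζ hζ]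
    exact mixed x y r hr z z' ζ hζ fun s => hj _ (hρ s).2
  · obtain ⟨x, y, r, hr⟩ := compl_path fun s => hj _ (hρ s).2
    obtain ⟨z, z', ζ, hζ⟩ := tube_path fun s => hi _ (hρ s).1
    rw [← hi' ρ (fun s => (hρ s).1) ζ hζ, ← hj' ρ (fun s => (hρ s).2) r hr]
    exact (mixed x y r hr z z' ζ hζ fun s => hi _ (hρ s).1).symm
  · obtain ⟨z, z', ζ, hζ⟩ := tube_path fun s => hi _ (hρ s).1
    rw [← hi' ρ (fun s => (hρ s).1) ζ hζ, ← hj' ρ (fun s => (hρ s).2) ζ hζ]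

end Section

/-- A path functional on the knot complement that is trivial on the meridians has a potential. -/
theorem KillsMeridians.exists_potential (h : N.KillsMeridians H) :
    ∃ c : K.Complement → G, ∀ {x y : K.Complement} (r : Path x y), H.val r = (c x)⁻¹ * c y := by
  obtain ⟨q, sec, hsec, hq⟩ := S3.exists_cube_parametrization (N.tube (1, 0))
  have hne : ∀ x : K.Complement, (x : S3) ≠ N.tube (1, 0) := fun x hx =>
    x.2 (hx ▸ N.tube_mem_range_curve.2 rfl)
  have hsec' : Continuous fun x : K.Complement => sec x :=
    hsec.comp_continuous continuous_subtype_val hne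
  -- For the discrete topology, a continuous ratio to a local section is locally constant, so `s ∘
  -- sec` is locally a potential.
  let _ : TopologicalSpace G := ⊥
  have : DiscreteTopology G := ⟨rfl⟩
  obtain ⟨s, hs⟩ := exists_isTorsorSection_Icc (B := fun i : LocalSection N H q => i.base)
    (c := fun i => i.toFun) (fun i => i.isOpen)
    (fun i j a ha => continuousWithinAt_const.congr
      (fun b hb => LocalSection.toFun_mul_inv_eq h i j hb ha) rfl) (-1) 1 fun x _ => by
      by_cases hx : q x ∈ Set.range K.curve
      · obtain ⟨i, hi⟩ := exists_localSection_tube (H := H) q x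
          (N.mem_range_tube_of_mem_range_curve hx)
        exact Set.mem_iUnion.2 ⟨i, hi⟩
      · obtain ⟨i, hi, -⟩ := exists_localSection_compl (N := N) (H := H) q x hx
        exact Set.mem_iUnion.2 ⟨i, hi⟩
  refine ⟨fun x => s (sec x), fun {x y} r => H.val_eq_of_locally r (fun x => s (sec x)) fun t => ?_⟩
  have hqs : ∀ x : K.Complement, q (sec x) = x := fun x => (hq x (hne x)).2
  obtain ⟨i, hi, -, hi'⟩ := exists_localSection_compl (N := N) (H := H) q (sec (r t))
    (by rw [hqs]; exact (r t).2)
  have hcont : ContinuousWithinAt (fun t' => s (sec (r t')) * (i.toFun (sec (r t')))⁻¹)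
      ((fun t' => sec (r t')) ⁻¹' i.base) t :=
    (hs i (sec (r t)) ⟨hi, (hq _ (hne _)).1⟩).comp (f := fun t' => sec (r t'))
      (hsec'.comp r.continuous).continuousWithinAt fun t' ht' => ⟨ht', (hq _ (hne _)).1⟩
  have hbase : (fun t' => sec (r t')) ⁻¹' i.base ∈ nhds t :=
    (i.isOpen.preimage (hsec'.comp r.continuous)).mem_nhds hi
  have hconst := (hcont.continuousAt hbase).eventually
    ((isOpen_discrete {s (sec (r t)) * (i.toFun (sec (r t)))⁻¹}).mem_nhds rfl)
  refine ⟨_, Filter.inter_mem hbase hconst, fun {a b} p hp => ?_⟩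
  have hval := hi' (a := sec (r a)) (b := sec (r b)) (p.map (hsec'.comp r.continuous))
    (fun u => (hp ⟨u, rfl⟩).1) (p.map r.continuous) fun u => (hqs _).symm
  have ha : s (sec (r a)) * (i.toFun (sec (r a)))⁻¹ = s (sec (r t)) * (i.toFun (sec (r t)))⁻¹ :=
    (hp ⟨0, p.source⟩).2
  have hb : s (sec (r b)) * (i.toFun (sec (r b)))⁻¹ = s (sec (r t)) * (i.toFun (sec (r t)))⁻¹ :=
    (hp ⟨1, p.target⟩).2
  rw [mul_inv_eq_iff_eq_mul] at ha hb
  rw [hval, ha, hb]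
  group

/-! ### Generation of the knot group by meridians -/

variable {x₀ : N.Exterior}

/-- The knot group is normally generated by the meridians. -/
theorem eq_one_of_meridian (φ : N.KnotGroup x₀ →* G) (hφ : ∀ α, φ (meridian α) = 1) : φ = 1 := by
  let P : ∀ x, Path (N.inclusion x₀) x := fun x => (N.exists_path_complement x₀ x).some
  let H := holonomyOfHom φ P
  have hloop : ∀ p : Path (N.inclusion x₀) (N.inclusion x₀), H.val p =
      φ (loopClass (P (N.inclusion x₀))) * φ (loopClass p) *
        (φ (loopClass (P (N.inclusion x₀))))⁻¹ := fun p => by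
    rw [← map_inv, ← loopClass_symm, ← map_mul, ← map_mul, mul_assoc]
    rfl
  have hH : N.KillsMeridians H := by
    intro p
    obtain ⟨α, rfl⟩ := exists_boundaryPath_endpoint (x₀ := x₀) p
    have h1 := hloop (α.loop.map N.inclusion.continuous)
    -- The loop of `α` is a conjugate of the bare meridian in the groupoid, so triviality passes to
    -- the latter.
    rw [← meridian_toQuandle, hφ, mul_one, mul_inv_cancel, holonomy_val_loop,
      mul_inv_eq_one, mul_eq_left] at h1
    exact h1
  obtain ⟨c, hc⟩ := hH.exists_potential
  ext γ
  obtain ⟨p, rfl⟩ := loopClass_surjective γ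
  have h1 := hloop p
  rw [hc, inv_mul_cancel] at h1
  rw [MonoidHom.one_apply]
  have h2 := h1.symm
  rwa [mul_inv_eq_one, mul_eq_left] at h2

/-- Equivariance makes the subgroup normal. Its quotient map kills meridians, hence is trivial, so
its kernel is the whole group. -/
theorem closure_range_meridian : Subgroup.closure
    (Set.range fun α : N.KnotQuandle x₀ => (meridian α : N.KnotGroup x₀)) = ⊤ := by
  have hn : (Subgroup.closure
      (Set.range fun α : N.KnotQuandle x₀ => (meridian α : N.KnotGroup x₀))).Normal := by
    refine ⟨fun x hx γ => ?_⟩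
    induction hx using Subgroup.closure_induction with
    | mem x hx =>
      obtain ⟨α, rfl⟩ := hx
      exact Subgroup.subset_closure ⟨γ • α, meridian_smul_eq_conj γ α⟩
    | one => simp
    | mul x y _ _ hx hy => simpa [mul_assoc] using mul_mem hx hy
    | inv x _ hx => simpa [mul_assoc] using inv_mem hx
  rw [← QuotientGroup.ker_mk' (Subgroup.closure _),
    eq_one_of_meridian (QuotientGroup.mk' (Subgroup.closure _)) fun α => ?_, MonoidHom.ker_one]
  exact (QuotientGroup.eq_one_iff _).2 (Subgroup.subset_closure ⟨α, rfl⟩)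

theorem exists_meridionalAction : ∃ lk : N.KnotGroup x₀ →* Multiplicative ℂ,
    MeridionalAction (meridian : N.KnotQuandle x₀ →◃ Quandle.Conj (N.KnotGroup x₀)) lk := by
  obtain ⟨lk, hlk⟩ := exists_linking_character (N := N) (x₀ := x₀)
  exact ⟨lk, meridian_smul, closure_range_meridian, inferInstance, inferInstance, hlk⟩

end TubularNeighbourhood

/-! ### The Alexander fibration of a knot -/

theorem mainTheorem6 (K : Knot) (N : TubularNeighbourhood K) (x₀ : N.Exterior) :
    Nonempty (N.KnotQuandle x₀) ∧
    ∃ e : (N.KnotGroup x₀ →* ℂˣ) ≃* ℂˣ,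
      (∀ (τ : N.KnotGroup x₀ →* ℂˣ) (α : N.KnotQuandle x₀),
        e τ = τ (TubularNeighbourhood.meridian α)) ∧
      ∀ t : ℂˣ,
        (Function.Injective (AlexanderQuandle.toConjAGL1 t) ∧
          Set.range (AlexanderQuandle.toConjAGL1 t) = {A : AGL1 | AGL1.diag A = t}) ∧
        ∃ Ψ : (N.KnotQuandle x₀ →◃ AlexanderQuandle t) ≃
            {ρ : N.KnotGroup x₀ →* AGL1 | e (alexanderFibration ρ) = t},
          (∀ (f : N.KnotQuandle x₀ →◃ AlexanderQuandle t) (α : N.KnotQuandle x₀),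
            (Ψ f : N.KnotGroup x₀ →* AGL1) (TubularNeighbourhood.meridian α) =
              AlexanderQuandle.toConjAGL1 t (f α)) ∧
          ∀ u : {ρ : N.KnotGroup x₀ →* AGL1 | e (alexanderFibration ρ) = t} → ℂ,
            IsRegularOn {ρ : N.KnotGroup x₀ →* AGL1 | e (alexanderFibration ρ) = t} u ↔
              (fun f => u (Ψ f)) ∈ quandleRegularFunctions (N.KnotQuandle x₀) t := by
  obtain ⟨lk, h⟩ := TubularNeighbourhood.exists_meridionalAction (N := N) (x₀ := x₀)
  exact ⟨h.nonempty, h.evalEquiv, h.evalEquiv_apply, fun t =>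
    ⟨⟨AlexanderQuandle.toConjAGL1_injective t, AlexanderQuandle.range_toConjAGL1 t⟩,
      h.fibreEquiv t, h.fibreEquiv_apply, h.isRegularOn_iff t⟩⟩
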